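/- **Setting.** Let $\lambda$ be a partition of $N\ge 1$ and let $K$ be a field of characteristic $0$ containing an element $\alpha$ transcendental over $\mathbb{Q}$ (for instance $K=\mathbb{Q}(\alpha)$ or $\mathbb{C}(\alpha)$). All operators and permutations act on the right. Permutations are multiplied as $(\sigma\pi)(k)=\sigma(\pi(k))$, act on vectors by $(v\sigma)[k]=v[\sigma(k)]$, and $s_{ij}$ is the transposition $(i\;j)$, $s_i=s_{i,i+1}$, $\theta=s_1s_2\cdots s_{N-1}=[2,\dots,N,1]$. For $a\in K$ (or $a=1$) put $[v_1,\dots,v_N]\Psi^a=[v_2,\dots,v_N,v_1+a]$. For $v\in\mathbb{N}^N$ let $v^+$ be its decreasing rearrangement and $\sigma_v$ the permutation numbering the positions of $v$ from the largest entry to the smallest and from left to right among equal entries, so $v=v^+\sigma_v$. Write $u\preceq w$ if $u[1]+\dots+u[i]\le w[1]+\dots+w[i]$ for all $i$, $u\prec w$ if moreover $u\ne w$, and $u\lhd w$ if $u^+\prec w^+$, or $u^+=w^+$ and $u\prec w$. *Tableaux.* $\mathrm{Tab}_\lambda$ is the set of reverse standard tableaux of shape $\lambda$: fillings by $1,\dots,N$,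 each once, strictly decreasing along rows and columns. $\mathrm{CT}_\tau[k]$ is the content (column minus row) of the entry $k$, and $\tau^{(k,l)}$ is $\tau$ with entries $k,l$ exchanged. $\tau_\lambda$ is obtained by filling the columns from left to right, each starting from the first row, with $N,N-1,\dots,1$. The symmetric group acts on the space $V_\lambda$ with basis $\mathrm{Tab}_\lambda$ by Murphy's formula: with $b=1/(\mathrm{CT}_\tau[i]-\mathrm{CT}_\tau[i+1])$, $\tau s_i=b\tau$ if $b^2=1$; $\tau s_i=b\tau+\tau^{(i,i+1)}$ if $0<b\le\frac12$; $\tau s_i=b\tau+(1-b^2)\tau^{(i,i+1)}$ otherwise. *Polynomials.* $M_\lambda=K[x_1,\dots,x_N]\otimes V_\lambda$, where $x^v\sigma=x^{v\sigma}$, and $x^{v,\tau}:=x^v\otimes\tau\sigma_v$. The leading monomial of $P\in M_\lambda$ is $x^{v,\tau}$ if $P=c\,x^{v,\tau}+\sum_{v'\lhd v}c_{v',\tau'}x^{v',\tau'}$ with $c\neq0$. For $i\ne j$ let $p\,\partial_{ij}=(p-p\,s_{ij})/(x_i-x_j)$, and define (products of operators being applied from left to right) $$D_i=\tfrac{\partial}{\partial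 x_i}\otimes1+\tfrac1\alpha\sum_{j\ne i}\partial_{ij}\otimes s_{ij},\quad U_i=x_iD_i-\tfrac1\alpha\sum_{j<i}s_{ij}\otimes s_{ij},\quad \tilde\xi_i=\alpha U_i-\alpha,\quad \Psi=(\theta\otimes\theta)x_N .$$ *The graph $G_\lambda$.* Vertices are 4-tuples $(\tau,\zeta,v,\sigma)$ with $\tau\in\mathrm{Tab}_\lambda$, $\zeta\in K^N$, $v\in\mathbb{N}^N$, $\sigma\in\mathfrak{S}_N$, and one extra vertex $\varnothing$; the root is $(\tau_\lambda,\mathrm{CT}_{\tau_\lambda},0^N,\mathrm{id})$. Define $(\tau,\zeta,v,\sigma)s_i$ to be $(\tau,\zeta s_i,vs_i,\sigma s_i)$ if $v[i]\ne v[i+1]$; $(\tau^{(\sigma[i],\sigma[i+1])},\zeta s_i,v,\sigma)$ if $v[i]=v[i+1]$ and $\tau^{(\sigma[i],\sigma[i+1])}\in\mathrm{Tab}_\lambda$; and $(\tau,\zeta,v,\sigma)$ otherwise. The arrows from $(\tau,\zeta,v,\sigma)$ are: an arrow $s_i$ to $(\tau',\zeta',v',\sigma')=(\tau,\zeta,v,\sigma)s_i$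 if $v[i]<v[i+1]$, or if $v[i]=v[i+1]$ and $\tau$ is obtained from $\tau'$ by exchanging two integers $k<l$ with $\mathrm{CT}_\tau[k]\ge\mathrm{CT}_\tau[l]+2$; an arrow $\Psi$ to $(\tau,\zeta\Psi^\alpha,v\Psi^1,\sigma\theta)$; and an arrow $s_i$ (a fall) to $\varnothing$ if $(\tau,\zeta,v,\sigma)s_i=(\tau,\zeta,v,\sigma)$. A path is a finite sequence of consecutive arrows starting at the root. *The polynomials $J_{\mathcal P}$.* For the empty path $J_{[]}=1\otimes\tau_\lambda$. If $\mathcal P$ is a path $\mathcal P'$ ending at $(\tau,\zeta,v,\sigma)$ followed by one arrow $a$, then $J_{\mathcal P}=J_{\mathcal P'}\bigl(s_i\otimes s_i+\frac1{\zeta[i+1]-\zeta[i]}\bigr)$ if $a$ is labelled $s_i$ (falls included), and $J_{\mathcal P}=J_{\mathcal P'}\Psi$ if $a$ is labelled $\Psi$. **Theorem.** 1. If $\mathcal P$ is a path in $G_\lambda$ from the root to $(\tau,\zeta,v,\sigma)$, then $J_{\mathcal P}$ is nonzero, has leading monomial $x^{v,\tau}$, and satisfies $J_{\mathcal P}\tilde\xi_i=\zeta[i]J_{\mathcal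 P}$ for all $1\le i\le N$. 2. $J_{\mathcal P}$ depends only on the end point of $\mathcal P$, and in fact only on $(v,\tau)$; denote it by $J_{v,\tau}$. Every pair $(v,\tau)\in\mathbb{N}^N\times\mathrm{Tab}_\lambda$ occurs in the end point of some path, and $(J_{v,\tau})_{v\in\mathbb{N}^N,\,\tau\in\mathrm{Tab}_\lambda}$ is a $K$-basis of $M_\lambda$ consisting of simultaneous eigenfunctions of the $\tilde\xi_i$. 3. If $\mathcal P$ is a path leading to $\varnothing$, then $J_{\mathcal P}=0$. -/

import Mathlib

open scoped TensorProduct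

noncomputable section

namespace VectorJack

/-! ## Vectors, sorting and the dominance order

Throughout `N = n + 1 ≥ 1`, and positions and entries `1, …, N` are the elements of `Fin (n + 1)`.
A permutation `σ` acts on vectors on the right by `(v σ)[k] = v[σ(k)]`, that is, by `v ∘ σ`. -/

/-- The elementary transposition `s_i = (i i+1)`. -/
def s {n : ℕ} (i : Fin n) : Equiv.Perm (Fin (n + 1)) := Equiv.swap i.castSucc i.succ

/-- `θ = s_1 s_2 ⋯ s_{N-1} = [2, …, N, 1]`. -/
def theta (n : ℕ) : Equiv.Perm (Fin (n + 1)) := finRotate (n + 1)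

/-- The affine operation `[v_1, …, v_N] Ψ^a = [v_2, …, v_N, v_1 + a]`. -/
def affineVec {R : Type*} [Add R] {n : ℕ} (a : R) (v : Fin (n + 1) → R) : Fin (n + 1) → R :=
  fun k => if k = Fin.last n then v (theta n k) + a else v (theta n k)

/-- The standardization `σ_v`: positions are numbered from the largest entry of `v` to the
smallest one, and from left to right among equal entries.  (`Tuple.sort` is the stable sort.) -/
def standardization {N : ℕ} (v : Fin N → ℕ) : Equiv.Perm (Fin N) :=
  (Tuple.sort fun i => OrderDual.toDual (v i))⁻¹

/-- The decreasing rearrangement `v⁺`, so that `v = v⁺ σ_v`. -/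
def decr {N : ℕ} (v : Fin N → ℕ) : Fin N → ℕ := v ∘ ⇑(standardization v)⁻¹

/-- `u ⪯ w`: `u[1] + ⋯ + u[i] ≤ w[1] + ⋯ + w[i]` for all `i`. -/
def DomLE {N : ℕ} (u w : Fin N → ℕ) : Prop :=
  ∀ i : Fin N, ∑ j ∈ Finset.Iic i, u j ≤ ∑ j ∈ Finset.Iic i, w j

/-- `u ≺ w`. -/
def DomLT {N : ℕ} (u w : Fin N → ℕ) : Prop := DomLE u w ∧ u ≠ w

/-- `u ◁ w`: `u⁺ ≺ w⁺`, or `u⁺ = w⁺` and `u ≺ w`. -/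
def VecLT {N : ℕ} (u w : Fin N → ℕ) : Prop :=
  DomLT (decr u) (decr w) ∨ (decr u = decr w ∧ DomLT u w)

/-! ## Reverse standard tableaux -/

/-- A filling of `μ` by `1, …, N`, each once, given by the position `pos k = (row, column)` of each
entry `k`, is reverse standard if entries strictly decrease along every row and every column. -/
def IsReverseStandard {N : ℕ} {μ : YoungDiagram} (pos : Fin N ≃ {c : ℕ × ℕ // c ∈ μ.cells}) :
    Prop :=
  ∀ k l : Fin N,
    (((pos k).1.1 = (pos l).1.1 ∧ (pos k).1.2 < (pos l).1.2) ∨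
      ((pos k).1.2 = (pos l).1.2 ∧ (pos k).1.1 < (pos l).1.1)) → l < k

/-- `Tab_μ`, the reverse standard tableaux of shape `μ` with entries `1, …, N`. -/
def RST (μ : YoungDiagram) (N : ℕ) : Type :=
  {pos : Fin N ≃ {c : ℕ × ℕ // c ∈ μ.cells} // IsReverseStandard pos}

/-- The content `CT_τ[k]` (column minus row) of the entry `k`. -/
def content {μ : YoungDiagram} {N : ℕ} (τ : RST μ N) (k : Fin N) : ℤ :=
  ((τ.1 k).1.2 : ℤ) - ((τ.1 k).1.1 : ℤ)

/-- The filling `τ^{(k,l)}` obtained from `τ` by exchanging the entries `k` and `l`. -/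
def swapEntries {μ : YoungDiagram} {N : ℕ} (τ : RST μ N) (k l : Fin N) :
    Fin N ≃ {c : ℕ × ℕ // c ∈ μ.cells} :=
  (Equiv.swap k l).trans τ.1

/-- The key of a cell in the order column by column from left to right, each column starting with
the first row. -/
def colKey : ℕ × ℕ ↪ ℕ ×ₗ ℕ where
  toFun c := toLex (c.2, c.1)
  inj' := by
    rintro ⟨a, b⟩ ⟨c, d⟩ h
    have h' := toLex.injective h
    simp only [Prod.mk.injEq] at h' ⊢
    exact ⟨h'.2, h'.1⟩

theorem colKey_mem (μ : YoungDiagram) (x : ℕ ×ₗ ℕ) (hx : x ∈ μ.cells.map colKey) :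
    ((ofLex x).2, (ofLex x).1) ∈ μ.cells := by
  obtain ⟨c, hc, rfl⟩ := Finset.mem_map.1 hx
  exact hc

/-- The cells of `μ` listed column by column. -/
def colEquiv (μ : YoungDiagram) :
    {x : ℕ ×ₗ ℕ // x ∈ μ.cells.map colKey} ≃ {c : ℕ × ℕ // c ∈ μ.cells} where
  toFun x := ⟨((ofLex x.1).2, (ofLex x.1).1), colKey_mem μ x.1 x.2⟩
  invFun c := ⟨colKey c.1, Finset.mem_map_of_mem _ c.2⟩
  left_inv _ := rfl
  right_inv _ := rfl

/-- The filling by `N, N-1, …, 1` of the columns from left to right, each column being filled from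
its first row on. -/
def rootPos (μ : YoungDiagram) {N : ℕ} (h : μ.cells.card = N) :
    Fin N ≃ {c : ℕ × ℕ // c ∈ μ.cells} :=
  Fin.revPerm.trans <|
    ((μ.cells.map colKey).orderIsoOfFin (by rw [Finset.card_map, h])).toEquiv.trans (colEquiv μ)

theorem rootPos_isReverseStandard (μ : YoungDiagram) {N : ℕ} (h : μ.cells.card = N) :
    IsReverseStandard (rootPos μ h) := by
  intro k l hkl
  rw [← Fin.rev_lt_rev]
  rw [← ((μ.cells.map colKey).orderIsoOfFin (by rw [Finset.card_map, h])).lt_iff_lt]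
  rw [← Subtype.coe_lt_coe, Prod.Lex.lt_iff]
  rcases hkl with ⟨_, h2⟩ | ⟨h1, h2⟩
  · exact Or.inl h2
  · exact Or.inr ⟨h1, h2⟩

/-- The root tableau `τ_λ`. -/
def rootTab (μ : YoungDiagram) {N : ℕ} (h : μ.cells.card = N) : RST μ N :=
  ⟨rootPos μ h, rootPos_isReverseStandard μ h⟩

/-! ## The Yang–Baxter graph -/

/-- The labels of the arrows: `s_i` (`1 ≤ i < N`) and `Ψ`. -/
inductive Label (n : ℕ) : Type
  | s (i : Fin n) : Label n
  | psi : Label n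

/-- The 4-tuples `(τ, ζ, v, σ)`. -/
@[ext]
structure Vertex (K : Type*) (μ : YoungDiagram) (n : ℕ) where
  τ : RST μ (n + 1)
  ζ : Fin (n + 1) → K
  v : Fin (n + 1) → ℕ
  σ : Equiv.Perm (Fin (n + 1))

variable {K : Type*} [Field K] {μ : YoungDiagram} {n : ℕ}

open Classical in
/-- The action of `s_i` on 4-tuples. -/
def Vertex.actS (x : Vertex K μ n) (i : Fin n) : Vertex K μ n :=
  if x.v i.succ ≠ x.v i.castSucc then
    ⟨x.τ, x.ζ ∘ s i, x.v ∘ s i, x.σ * s i⟩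
  else if h : IsReverseStandard (swapEntries x.τ (x.σ i.castSucc) (x.σ i.succ)) then
    ⟨⟨swapEntries x.τ (x.σ i.castSucc) (x.σ i.succ), h⟩, x.ζ ∘ s i, x.v, x.σ⟩
  else x

/-- The action of `Ψ` on 4-tuples. -/
def Vertex.actPsi (α : K) (x : Vertex K μ n) : Vertex K μ n :=
  ⟨x.τ, affineVec α x.ζ, affineVec 1 x.v, x.σ * theta n⟩

/-- The root `(τ_λ, CT_{τ_λ}, 0^N, [1, …, N])`. -/
def root (K : Type*) [Field K] (μ : YoungDiagram) {n : ℕ} (hμ : μ.cells.card = n + 1) :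
    Vertex K μ n :=
  ⟨rootTab μ hμ, fun k => (content (rootTab μ hμ) k : K), fun _ => 0, 1⟩

/-- The arrows of the graph; `none` is the extra vertex `∅`. -/
inductive Arrow (α : K) : Vertex K μ n → Label n → Option (Vertex K μ n) → Prop
  /-- `s_i` raising the weight -/
  | step (x : Vertex K μ n) (i : Fin n) (hv : x.v i.castSucc < x.v i.succ) :
      Arrow α x (.s i) (some (x.actS i))
  /-- correct jump: `τ` is obtained from the new tableau by exchanging two integers `k < l` such
  that `k` is to the south-east of `l` in `τ` -/
  | jump (x : Vertex K μ n) (i : Fin n) (hv : x.v i.castSucc = x.v i.succ)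
      (hτ : ∃ k l : Fin (n + 1), k < l ∧ x.τ.1 = swapEntries (x.actS i).τ k l ∧
        content x.τ l + 2 ≤ content x.τ k) :
      Arrow α x (.s i) (some (x.actS i))
  | affine (x : Vertex K μ n) : Arrow α x .psi (some (x.actPsi α))
  | fall (x : Vertex K μ n) (i : Fin n) (hx : x.actS i = x) : Arrow α x (.s i) none

/-- Paths from the root, indexed by their end point (`none` for `∅`). -/
inductive Path (α : K) (hμ : μ.cells.card = n + 1) : Option (Vertex K μ n) → Type _
  | nil : Path α hμ (some (root K μ hμ))
  | snoc {x : Vertex K μ n} {y : Option (Vertex K μ n)} (P : Path α hμ (some x)) (a : Label n)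
      (h : Arrow α x a y) : Path α hμ y

/-! ## Young's seminormal representation in Murphy's form

All operators below act on the right: `P (A B) = (P A) B`. As Lean functions, `P (A B)` is
therefore `(B ∘ₗ A) P`. -/

/-- The vector space `V_μ` with basis the reverse standard tableaux. -/
abbrev V (K : Type*) [Field K] (μ : YoungDiagram) (n : ℕ) : Type _ := RST μ (n + 1) →₀ K

open Classical in
/-- `τ^{(k,l)}` as an element of `V_μ`, when it is a reverse standard tableau (which it is in all
cases where Murphy's formula uses it), and `0` otherwise. -/
def swapVec (K : Type*) [Field K] (τ : RST μ (n + 1)) (k l : Fin (n + 1)) : V K μ n :=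
  if h : IsReverseStandard (swapEntries τ k l) then Finsupp.single ⟨swapEntries τ k l, h⟩ 1 else 0

/-- `b_τ[i] = 1 / (CT_τ[i] - CT_τ[i+1])`. -/
def bCoeff (τ : RST μ (n + 1)) (i : Fin n) : ℚ :=
  1 / ((content τ i.castSucc : ℚ) - (content τ i.succ : ℚ))

/-- `τ s_i`, by Murphy's formula. -/
def murphyVec (K : Type*) [Field K] (i : Fin n) (τ : RST μ (n + 1)) : V K μ n :=
  if bCoeff τ i ^ 2 = 1 then
    Finsupp.single τ (bCoeff τ i : K)
  else if 0 < bCoeff τ i ∧ bCoeff τ i ≤ 1 / 2 then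
    Finsupp.single τ (bCoeff τ i : K) + swapVec K τ i.castSucc i.succ
  else
    Finsupp.single τ (bCoeff τ i : K) +
      (1 - (bCoeff τ i : K) ^ 2) • swapVec K τ i.castSucc i.succ

/-- The operator `τ ↦ τ s_i` on `V_μ`. -/
def murphy (K : Type*) [Field K] (μ : YoungDiagram) (i : Fin n) : V K μ n →ₗ[K] V K μ n :=
  Finsupp.linearCombination K (murphyVec K i)

/-- The permutation `s_{i_1} s_{i_2} ⋯ s_{i_k}`. -/
def wordProd (w : List (Fin n)) : Equiv.Perm (Fin (n + 1)) := (w.map s).prod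

/-- `τ ↦ (⋯((τ s_{i_1}) s_{i_2})⋯) s_{i_k}`. -/
def wordAct (K : Type*) [Field K] (μ : YoungDiagram) (w : List (Fin n)) :
    V K μ n →ₗ[K] V K μ n :=
  w.foldl (fun f i => murphy K μ i ∘ₗ f) LinearMap.id

theorem exists_word (σ : Equiv.Perm (Fin (n + 1))) : ∃ w : List (Fin n), wordProd w = σ := by
  have h : σ ∈ Submonoid.closure (Set.range fun i : Fin n => Equiv.swap i.castSucc i.succ) := by
    rw [Equiv.Perm.mclosure_swap_castSucc_succ]; trivial
  induction h using Submonoid.closure_induction with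
  | mem x hx =>
    obtain ⟨i, rfl⟩ := hx
    exact ⟨[i], by simp [wordProd, s]⟩
  | one => exact ⟨[], rfl⟩
  | mul x y _ _ hx hy =>
    obtain ⟨a, rfl⟩ := hx
    obtain ⟨b, rfl⟩ := hy
    exact ⟨a ++ b, by simp [wordProd]⟩

theorem exists_reduced_word (σ : Equiv.Perm (Fin (n + 1))) :
    ∃ w : List (Fin n), wordProd w = σ ∧ ∀ w', wordProd w' = σ → w.length ≤ w'.length := by
  classical
  have h : ∃ k, ∃ w : List (Fin n), wordProd w = σ ∧ w.length = k := by
    obtain ⟨w, hw⟩ := exists_word σ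
    exact ⟨_, w, hw, rfl⟩
  obtain ⟨w, hw, hk⟩ := Nat.find_spec h
  exact ⟨w, hw, fun w' hw' => hk ▸ Nat.find_min' h ⟨w', hw', rfl⟩⟩

/-- A reduced word of `σ`. -/
def reducedWord (σ : Equiv.Perm (Fin (n + 1))) : List (Fin n) :=
  Classical.choose (exists_reduced_word σ)

theorem wordProd_reducedWord (σ : Equiv.Perm (Fin (n + 1))) : wordProd (reducedWord σ) = σ :=
  (Classical.choose_spec (exists_reduced_word σ)).1

/-- The right action `τ ↦ τ σ` of the symmetric group on `V_μ`, generated by Murphy's formula for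
`τ s_i`. It is computed along a reduced word of `σ`; Murphy's operators satisfy the Coxeter
relations, so any other word gives the same operator. -/
def tabAct (K : Type*) [Field K] (μ : YoungDiagram) (σ : Equiv.Perm (Fin (n + 1))) :
    V K μ n →ₗ[K] V K μ n :=
  wordAct K μ (reducedWord σ)

theorem s_injective : Function.Injective (s : Fin n → Equiv.Perm (Fin (n + 1))) := by
  intro i j hij
  have h : s i i.castSucc = s j i.castSucc := by rw [hij]
  simp only [s, Equiv.swap_apply_left] at h
  rw [Equiv.swap_apply_def] at h
  split_ifs at h with h1 h2
  · exact Fin.castSucc_injective _ h1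
  · rw [Fin.ext_iff] at h h2
    simp only [Fin.val_succ, Fin.val_castSucc] at h h2
    omega
  · simp [Fin.ext_iff] at h

theorem tabAct_s (i : Fin n) : tabAct K μ (s i) = murphy K μ i := by
  have hw := Classical.choose_spec (exists_reduced_word (s i))
  have key : reducedWord (s i) = [i] := by
    change wordProd (reducedWord (s i)) = _ ∧
      (∀ w' : List (Fin n), wordProd w' = s i → (reducedWord (s i)).length ≤ w'.length) at hw
    have hlen := hw.2 [i] (by simp [wordProd])
    have hp := hw.1
    match hr : reducedWord (s i), hlen, hp with
    | [], _, hp =>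
      have h : s i i.castSucc = i.castSucc := by
        rw [← hp]; rfl
      simp [s, Fin.ext_iff] at h
    | [j], _, hp =>
      have h : s j = s i := by simpa [wordProd] using hp
      rw [s_injective h]
    | _ :: _ :: _, hlen, _ => simp at hlen
  simp [tabAct, key, wordAct]

/-! ## Vector-valued polynomials and the operators acting on them -/

/-- `M_μ`, spanned by the `x^v ⊗ τ`. -/
abbrev M (K : Type*) [Field K] (μ : YoungDiagram) (n : ℕ) : Type _ :=
  MvPolynomial (Fin (n + 1)) K ⊗[K] V K μ n

/-- The right action on polynomials, `x^v ↦ x^{v σ}`. -/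
def polyAct (K : Type*) [Field K] (σ : Equiv.Perm (Fin (n + 1))) :
    MvPolynomial (Fin (n + 1)) K →ₗ[K] MvPolynomial (Fin (n + 1)) K :=
  (MvPolynomial.rename (σ⁻¹ : Equiv.Perm (Fin (n + 1)))).toLinearMap

/-- The operator `σ ⊗ σ`. -/
def diagAct (K : Type*) [Field K] (μ : YoungDiagram) (σ : Equiv.Perm (Fin (n + 1))) :
    M K μ n →ₗ[K] M K μ n :=
  TensorProduct.map (polyAct K σ) (tabAct K μ σ)

/-- Multiplication by `x_i`. -/
def mulX (K : Type*) [Field K] (μ : YoungDiagram) (i : Fin (n + 1)) : M K μ n →ₗ[K] M K μ n :=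
  TensorProduct.map (LinearMap.mulLeft K (MvPolynomial.X i)) LinearMap.id

theorem sub_swap_dvd (i j : Fin (n + 1)) (p : MvPolynomial (Fin (n + 1)) K) :
    (MvPolynomial.X i - MvPolynomial.X j : MvPolynomial (Fin (n + 1)) K) ∣
      p - polyAct K (Equiv.swap i j) p := by
  set I : Ideal (MvPolynomial (Fin (n + 1)) K) :=
    Ideal.span {MvPolynomial.X i - MvPolynomial.X j}
  rw [← Ideal.mem_span_singleton, ← Ideal.Quotient.eq]
  have hX : Ideal.Quotient.mk I (MvPolynomial.X i) = Ideal.Quotient.mk I (MvPolynomial.X j) :=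
    Ideal.Quotient.eq.2 (Ideal.mem_span_singleton_self _)
  have h : Ideal.Quotient.mkₐ K I =
      (Ideal.Quotient.mkₐ K I).comp
        (MvPolynomial.rename ((Equiv.swap i j)⁻¹ : Equiv.Perm (Fin (n + 1)))) := by
    apply MvPolynomial.algHom_ext
    intro k
    simp only [Equiv.swap_inv, AlgHom.comp_apply, MvPolynomial.rename_X,
      Ideal.Quotient.mkₐ_eq_mk]
    rw [Equiv.swap_apply_def]
    split_ifs with h1 h2
    · rw [h1, hX]
    · rw [h2, hX]
    · rfl
  exact DFunLike.congr_fun h p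

theorem X_sub_X_ne_zero {i j : Fin (n + 1)} (h : i ≠ j) :
    (MvPolynomial.X i - MvPolynomial.X j : MvPolynomial (Fin (n + 1)) K) ≠ 0 :=
  sub_ne_zero.2 fun h' => h (MvPolynomial.X_injective h')

/-- The divided difference `∂_{ij} : p ↦ (p - p s_{ij}) / (x_i - x_j)`, for `i ≠ j`. -/
def divDiff (K : Type*) [Field K] (i j : Fin (n + 1)) (h : i ≠ j) :
    MvPolynomial (Fin (n + 1)) K →ₗ[K] MvPolynomial (Fin (n + 1)) K where
  toFun p := Classical.choose (sub_swap_dvd i j p)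
  map_add' p q := by
    apply mul_left_cancel₀ (X_sub_X_ne_zero (K := K) h)
    rw [mul_add, ← Classical.choose_spec (sub_swap_dvd i j p),
      ← Classical.choose_spec (sub_swap_dvd i j q),
      ← Classical.choose_spec (sub_swap_dvd i j (p + q)), map_add]
    ring
  map_smul' c p := by
    apply mul_left_cancel₀ (X_sub_X_ne_zero (K := K) h)
    rw [RingHom.id_apply, mul_smul_comm, ← Classical.choose_spec (sub_swap_dvd i j p),
      ← Classical.choose_spec (sub_swap_dvd i j (c • p)), map_smul, smul_sub]

theorem mul_divDiff (i j : Fin (n + 1)) (h : i ≠ j) (p : MvPolynomial (Fin (n + 1)) K) :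
    (MvPolynomial.X i - MvPolynomial.X j) * divDiff K i j h p =
      p - polyAct K (Equiv.swap i j) p :=
  (Classical.choose_spec (sub_swap_dvd i j p)).symm

/-- The Dunkl operator `D_i = ∂/∂x_i ⊗ 1 + (1/α) ∑_{j ≠ i} ∂_{ij} ⊗ s_{ij}`. -/
def dunkl (μ : YoungDiagram) (α : K) (i : Fin (n + 1)) : M K μ n →ₗ[K] M K μ n :=
  TensorProduct.map (MvPolynomial.pderiv i).toLinearMap LinearMap.id +
    α⁻¹ • ∑ j : {j : Fin (n + 1) // i ≠ j},
      TensorProduct.map (divDiff K i j.1 j.2) (tabAct K μ (Equiv.swap i j.1))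

/-- The Cherednik–Dunkl operator `U_i = x_i D_i - (1/α) ∑_{j < i} s_{ij} ⊗ s_{ij}`
(first multiply by `x_i`, then apply `D_i`). -/
def cherednikU (μ : YoungDiagram) (α : K) (i : Fin (n + 1)) : M K μ n →ₗ[K] M K μ n :=
  dunkl μ α i ∘ₗ mulX K μ i - α⁻¹ • ∑ j ∈ Finset.Iio i, diagAct K μ (Equiv.swap i j)

/-- `ξ̃_i = α U_i - α`. -/
def xi (μ : YoungDiagram) (α : K) (i : Fin (n + 1)) : M K μ n →ₗ[K] M K μ n :=
  α • cherednikU μ α i - α • LinearMap.id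

/-- `Ψ = (θ ⊗ θ) x_N` (first `θ ⊗ θ`, then multiply by `x_N`). -/
def psiOp (K : Type*) [Field K] (μ : YoungDiagram) (n : ℕ) : M K μ n →ₗ[K] M K μ n :=
  mulX K μ (Fin.last n) ∘ₗ diagAct K μ (theta n)

/-- `x^{v,τ} = x^v ⊗ τ σ_v`. -/
def mono (K : Type*) [Field K] (v : Fin (n + 1) → ℕ) (τ : RST μ (n + 1)) : M K μ n :=
  (∏ k, MvPolynomial.X k ^ v k) ⊗ₜ[K] tabAct K μ (standardization v) (Finsupp.single τ 1)

/-- `x^{v,τ}` is the leading monomial of `P`: up to a nonzero scalar multiple of `x^{v,τ}`, `P` is a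
linear combination of `x^{v',τ'}` with `v' ◁ v`. -/
def IsLeadingMonomial (v : Fin (n + 1) → ℕ) (τ : RST μ (n + 1)) (P : M K μ n) : Prop :=
  ∃ c : K, c ≠ 0 ∧ P - c • mono K v τ ∈
    Submodule.span K {Q : M K μ n | ∃ v' τ', VecLT v' v ∧ Q = mono K v' τ'}

/-- The polynomial `J_P` attached to a path `P` in the graph. -/
def J {α : K} {hμ : μ.cells.card = n + 1} :
    {y : Option (Vertex K μ n)} → Path α hμ y → M K μ n
  | _, .nil => 1 ⊗ₜ[K] Finsupp.single (rootTab μ hμ) 1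
  | _, .snoc (x := x) P (.s i) _ =>
      diagAct K μ (s i) (J P) + (1 / (x.ζ i.succ - x.ζ i.castSucc)) • J P
  | _, .snoc P .psi _ => psiOp K μ n (J P)

end VectorJack

end

noncomputable section

namespace VectorJack

/-! ## The Coxeter presentation of the symmetric group -/

section Coxeter

variable {n : ℕ}

theorem s_castSucc (i : Fin n) : s i i.castSucc = i.succ := Equiv.swap_apply_left _ _

theorem s_succ (i : Fin n) : s i i.succ = i.castSucc := Equiv.swap_apply_right _ _

theorem s_of_ne {i : Fin n} {k : Fin (n + 1)} (h : k ≠ i.castSucc) (h' : k ≠ i.succ) :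
    s i k = k := Equiv.swap_apply_of_ne_of_ne h h'

theorem s_mul_s (i : Fin n) : s i * s i = 1 := Equiv.swap_mul_self _ _

theorem mul_s_mul_s (σ : Equiv.Perm (Fin (n + 1))) (i : Fin n) : σ * s i * s i = σ := by
  rw [mul_assoc, s_mul_s, mul_one]

theorem s_involutive (i : Fin n) (k : Fin (n + 1)) : s i (s i k) = k := Equiv.swap_apply_self _ _ _

theorem s_comm {i j : Fin n} (h : i.val + 1 < j.val) : s i * s j = s j * s i := by
  refine (Equiv.Perm.Disjoint.commute ?_).eq
  rw [s, s, Equiv.Perm.disjoint_iff_eq_or_eq]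
  intro k
  by_cases h1 : k = i.castSucc ∨ k = i.succ
  · right
    apply Equiv.swap_apply_of_ne_of_ne <;> rintro rfl <;> simp [Fin.ext_iff] at h1 <;> omega
  · push Not at h1
    exact Or.inl (Equiv.swap_apply_of_ne_of_ne h1.1 h1.2)

theorem s_braid {i j : Fin n} (h : j.val = i.val + 1) : s i * s j * s i = s j * s i * s j := by
  have hj : j.castSucc = i.succ := by ext; simp [h]
  have h1 : i.castSucc ≠ i.succ := by simp [Fin.ext_iff]
  have h2 : i.castSucc ≠ j.succ := by simp [Fin.ext_iff]; omega
  have h3 : i.succ ≠ j.succ := by simp [Fin.ext_iff]; omega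
  have e1 := Equiv.swap_mul_swap_mul_swap (x := i.castSucc) (y := i.succ) (z := j.succ) h1 h2
  have e2 := Equiv.swap_mul_swap_mul_swap (x := j.succ) (y := i.succ) (z := i.castSucc)
    h3.symm h2.symm
  simp only [s, hj]
  rw [Equiv.swap_comm i.succ j.succ, Equiv.swap_comm i.castSucc i.succ, e2,
    Equiv.swap_comm j.succ i.succ, Equiv.swap_comm i.succ i.castSucc, e1, Equiv.swap_comm]

/-- A natural number that decreases when a descent is removed. -/
def descentWeight (σ : Equiv.Perm (Fin (n + 1))) : ℕ := ∑ k, k.val * (σ k).rev.val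

/-- Only positions `i` and `i + 1` matter: the smaller reversed value moves to the larger position,
and the sum drops by the difference of the two values. -/
theorem descentWeight_lt {σ : Equiv.Perm (Fin (n + 1))} {i : Fin n}
    (h : σ i.succ < σ i.castSucc) : descentWeight (σ * s i) < descentWeight σ := by
  have key : ∀ f : Fin (n + 1) → ℕ, ∑ k, f k =
      f i.castSucc + f i.succ + ∑ k ∈ (Finset.univ.erase i.castSucc).erase i.succ, f k := by
    intro f
    rw [add_assoc, Finset.add_sum_erase _ f (by simp [Fin.ext_iff]),
      Finset.add_sum_erase _ f (Finset.mem_univ i.castSucc)]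
  have hc : ∑ k ∈ (Finset.univ.erase i.castSucc).erase i.succ, k.val * ((σ * s i) k).rev.val =
      ∑ k ∈ (Finset.univ.erase i.castSucc).erase i.succ, k.val * (σ k).rev.val := by
    refine Finset.sum_congr rfl fun k hk => ?_
    simp only [Finset.mem_erase] at hk
    rw [Equiv.Perm.mul_apply, s_of_ne hk.2.1 hk.1]
  rw [descentWeight, descentWeight, key, key, hc]
  simp only [Equiv.Perm.mul_apply, s_castSucc, s_succ, Fin.val_castSucc, Fin.val_succ, Fin.val_rev]
  have := (σ i.castSucc).is_lt
  have h' : (σ i.succ).val < (σ i.castSucc).val := h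
  zify [show (σ i.castSucc).val + 1 ≤ n + 1 by omega, show (σ i.succ).val + 1 ≤ n + 1 by omega] at *
  linarith

open Classical in
/-- The product of the `f i` along the word of `σ` obtained by successively removing descents. -/
def descentProd {G : Type*} [Monoid G] (f : Fin n → G) (σ : Equiv.Perm (Fin (n + 1))) : G :=
  if h : ∃ i : Fin n, σ i.succ < σ i.castSucc then descentProd f (σ * s h.choose) * f h.choose
  else 1
termination_by descentWeight σ
decreasing_by exact descentWeight_lt h.choose_spec

/-- The core of Matsumoto's theorem: the descent stripped first is irrelevant. Two distinct descents
are either far apart and commute, or adjacent, and then both sides of the braid relation can be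
stripped; the remaining factors agree by induction on the weight. -/
theorem descentProd_descent {G : Type*} [Monoid G] {f : Fin n → G}
    (hcomm : ∀ i j, i.val + 1 < j.val → f i * f j = f j * f i)
    (hbraid : ∀ i j, j.val = i.val + 1 → f i * f j * f i = f j * f i * f j)
    (σ : Equiv.Perm (Fin (n + 1))) (j : Fin n) (hj : σ j.succ < σ j.castSucc) :
    descentProd f σ = descentProd f (σ * s j) * f j := by
  induction hm : descentWeight σ using Nat.strong_induction_on generalizing σ j with
  | _ m ih =>
  subst hm
  suffices H : ∀ i k : Fin n, i.val ≤ k.val → σ i.succ < σ i.castSucc → σ k.succ < σ k.castSucc →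
      descentProd f (σ * s i) * f i = descentProd f (σ * s k) * f k by
    have h : ∃ i : Fin n, σ i.succ < σ i.castSucc := ⟨j, hj⟩
    rw [descentProd, dif_pos h]
    rcases le_total h.choose.val j.val with h' | h'
    · exact H _ _ h' h.choose_spec hj
    · exact (H _ _ h' hj h.choose_spec).symm
  intro i k hik hi hk
  have li := descentWeight_lt hi
  have lk := descentWeight_lt hk
  rcases hik.eq_or_lt with h | h
  · rw [Fin.ext h]
  rcases (Nat.succ_le_of_lt h).eq_or_lt with h | h
  · have e : k.castSucc = i.succ := by ext; simp [← h]
    have n1 : k.succ ≠ i.castSucc := by simp [Fin.ext_iff]; omega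
    have n2 : k.succ ≠ i.succ := by simp [Fin.ext_iff]; omega
    have n3 : i.castSucc ≠ k.castSucc := by simp [Fin.ext_iff]; omega
    have n4 : i.castSucc ≠ k.succ := n1.symm
    have ski : s k i.castSucc = i.castSucc := s_of_ne n3 n4
    have sik : s i k.succ = k.succ := s_of_ne n1 n2
    have sk1 : s k i.succ = k.succ := by rw [← e, s_castSucc]
    have si1 : s i k.castSucc = i.castSucc := by rw [e, s_succ]
    -- The values at `i`, `i + 1`, `i + 2` decrease, so a descent remains after each of the first
    -- two removals, in either order.
    have d1 : (σ * s i) k.succ < (σ * s i) k.castSucc := by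
      simp only [Equiv.Perm.mul_apply, sik, si1]
      exact hk.trans (e ▸ hi)
    have d2 : (σ * s i * s k) i.succ < (σ * s i * s k) i.castSucc := by
      simp only [Equiv.Perm.mul_apply, sk1, ski, sik, s_castSucc]
      exact e ▸ hk
    have d3 : (σ * s k) i.succ < (σ * s k) i.castSucc := by
      simp only [Equiv.Perm.mul_apply, sk1, ski]
      exact hk.trans (e ▸ hi)
    have d4 : (σ * s k * s i) k.succ < (σ * s k * s i) k.castSucc := by
      simp only [Equiv.Perm.mul_apply, sik, ski, s_succ, e]
      exact hi
    rw [ih _ li _ _ d1 rfl, ih _ ((descentWeight_lt d1).trans li) _ _ d2 rfl,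
      ih _ lk _ _ d3 rfl, ih _ ((descentWeight_lt d3).trans lk) _ _ d4 rfl]
    have hb := s_braid h.symm
    simp only [mul_assoc] at hb ⊢
    have hf := hbraid i k h.symm
    simp only [mul_assoc] at hf
    rw [hb, hf]
  · have h : i.val + 1 < k.val := h
    have d1 : (σ * s i) k.succ < (σ * s i) k.castSucc := by
      simp only [Equiv.Perm.mul_apply]
      rw [s_of_ne, s_of_ne]
      · exact hk
      all_goals simp [Fin.ext_iff]; omega
    have d2 : (σ * s k) i.succ < (σ * s k) i.castSucc := by
      simp only [Equiv.Perm.mul_apply]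
      rw [s_of_ne, s_of_ne]
      · exact hi
      all_goals simp [Fin.ext_iff]; omega
    rw [ih _ li _ _ d1 rfl, ih _ lk _ _ d2 rfl, mul_assoc, mul_assoc, mul_assoc, mul_assoc,
      s_comm h, hcomm i k h]

theorem descentProd_mul_s {G : Type*} [Monoid G] {f : Fin n → G} (hsq : ∀ i, f i * f i = 1)
    (hcomm : ∀ i j, i.val + 1 < j.val → f i * f j = f j * f i)
    (hbraid : ∀ i j, j.val = i.val + 1 → f i * f j * f i = f j * f i * f j)
    (σ : Equiv.Perm (Fin (n + 1))) (j : Fin n) :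
    descentProd f (σ * s j) = descentProd f σ * f j := by
  rcases lt_or_ge (σ j.succ) (σ j.castSucc) with h | h
  · rw [descentProd_descent hcomm hbraid σ j h, mul_assoc, hsq, mul_one]
  · have h' : σ j.castSucc < σ j.succ :=
      lt_of_le_of_ne h fun h' => by simpa [Fin.ext_iff] using σ.injective h'
    rw [descentProd_descent hcomm hbraid (σ * s j) j, mul_s_mul_s]
    simpa [Equiv.Perm.mul_apply, s_castSucc, s_succ] using h'

/-- The word need not be reduced: a letter at a descent is absorbed by `f i * f i = 1`. Hence the
product along a word depends only on its permutation. -/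
theorem descentProd_wordProd {G : Type*} [Monoid G] {f : Fin n → G} (hsq : ∀ i, f i * f i = 1)
    (hcomm : ∀ i j, i.val + 1 < j.val → f i * f j = f j * f i)
    (hbraid : ∀ i j, j.val = i.val + 1 → f i * f j * f i = f j * f i * f j)
    (w : List (Fin n)) : descentProd f (wordProd w) = (w.map f).prod := by
  induction w using List.reverseRecOn with
  | nil =>
    rw [descentProd, dif_neg]
    · simp
    · rintro ⟨i, hi⟩
      simp [wordProd, Fin.lt_def] at hi
  | append_singleton w i ih =>
    have : wordProd (w ++ [i]) = wordProd w * s i := by simp [wordProd]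
    rw [this, descentProd_mul_s hsq hcomm hbraid, ih]
    simp

end Coxeter

/-! ## Contents of reverse standard tableaux -/

section Tableaux

variable {μ : YoungDiagram} {n : ℕ}

/-- If the cells share neither row nor column, both are compared with the entry in the cell at the
row of `k` and the column of `l`. -/
theorem RST.lt_of_le_of_le {N : ℕ} (τ : RST μ N) {k l : Fin N} (hr : (τ.1 k).1.1 ≤ (τ.1 l).1.1)
    (hc : (τ.1 k).1.2 ≤ (τ.1 l).1.2) (hkl : k ≠ l) : l < k := by
  rcases hr.eq_or_lt with h1 | h1
  · rcases hc.eq_or_lt with h2 | h2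
    · exact absurd (τ.1.injective (Subtype.ext (Prod.ext h1 h2))) hkl
    · exact τ.2 k l (Or.inl ⟨h1, h2⟩)
  rcases hc.eq_or_lt with h2 | h2
  · exact τ.2 k l (Or.inr ⟨h2, h1⟩)
  have hm : ((τ.1 k).1.1, (τ.1 l).1.2) ∈ μ.cells :=
    μ.up_left_mem hr le_rfl (τ.1 l).2
  have e := τ.1.apply_symm_apply ⟨_, hm⟩
  set m := τ.1.symm ⟨_, hm⟩
  have hmk : m < k := τ.2 k m (Or.inl (by simp [e, h2]))
  have hlm : l < m := τ.2 m l (Or.inr (by simp [e, h1]))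
  exact hlm.trans hmk

/-- The other two corners of the rectangle spanned by the cells contain two different entries
strictly between `k` and `l`. -/
theorem RST.not_both_lt {N : ℕ} (τ : RST μ N) {k l : Fin N} (hr : (τ.1 l).1.1 < (τ.1 k).1.1)
    (hc : (τ.1 l).1.2 < (τ.1 k).1.2) : k.val + 2 < l.val := by
  have hm : ((τ.1 l).1.1, (τ.1 k).1.2) ∈ μ.cells := μ.up_left_mem hr.le le_rfl (τ.1 k).2
  have hm' : ((τ.1 k).1.1, (τ.1 l).1.2) ∈ μ.cells := μ.up_left_mem le_rfl hc.le (τ.1 k).2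
  have e := τ.1.apply_symm_apply ⟨_, hm⟩
  have e' := τ.1.apply_symm_apply ⟨_, hm'⟩
  set m := τ.1.symm ⟨_, hm⟩
  set m' := τ.1.symm ⟨_, hm'⟩
  have h1 : m < l := τ.2 l m (Or.inl (by simp [e, hc]))
  have h2 : m' < l := τ.2 l m' (Or.inr (by simp [e', hr]))
  have h3 : k < m := τ.2 m k (Or.inr (by simp [e, hr]))
  have h4 : k < m' := τ.2 m' k (Or.inl (by simp [e', hc]))
  have h5 : m.val ≠ m'.val := by
    intro h
    have h := congrArg (fun x => x.1.1) (e.symm.trans ((congrArg τ.1 (Fin.ext h)).trans e'))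
    simp only at h
    omega
  simp only [Fin.lt_def] at *
  omega

/-- Equal contents put both entries on one diagonal with the larger one strictly to the north-west,
and then they differ by at least 3. The braid relation needs distances 1 and 2. -/
theorem RST.content_ne {N : ℕ} (τ : RST μ N) {k l : Fin N} (hkl : k < l) (h : l.val ≤ k.val + 2) :
    content τ k ≠ content τ l := by
  intro he
  have h1 : ¬ ((τ.1 k).1.1 ≤ (τ.1 l).1.1 ∧ (τ.1 k).1.2 ≤ (τ.1 l).1.2) :=
    fun h' => lt_asymm hkl (τ.lt_of_le_of_le h'.1 h'.2 hkl.ne)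
  have h2 : ¬ ((τ.1 l).1.1 < (τ.1 k).1.1 ∧ (τ.1 l).1.2 < (τ.1 k).1.2) :=
    fun h' => absurd (τ.not_both_lt h'.1 h'.2) (by omega)
  simp only [content] at he
  omega

theorem s_lt_s {i : Fin n} {k l : Fin (n + 1)} (hlk : l < k)
    (h : ¬ (l = i.castSucc ∧ k = i.succ)) : s i l < s i k := by
  simp only [s, Equiv.swap_apply_def]
  simp only [Fin.ext_iff, Fin.lt_def, Fin.val_castSucc, Fin.val_succ] at *
  split_ifs <;> first | omega | (simp only [Fin.val_castSucc, Fin.val_succ]; omega)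

theorem swapEntries_isReverseStandard (τ : RST μ (n + 1)) (i : Fin n)
    (hr : (τ.1 i.castSucc).1.1 ≠ (τ.1 i.succ).1.1) (hc : (τ.1 i.castSucc).1.2 ≠ (τ.1 i.succ).1.2) :
    IsReverseStandard (swapEntries τ i.castSucc i.succ) := by
  intro k l hkl
  change ((τ.1 (s i k)).1.1 = (τ.1 (s i l)).1.1 ∧ (τ.1 (s i k)).1.2 < (τ.1 (s i l)).1.2 ∨
    (τ.1 (s i k)).1.2 = (τ.1 (s i l)).1.2 ∧ (τ.1 (s i k)).1.1 < (τ.1 (s i l)).1.1) at hkl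
  have h := τ.2 _ _ hkl
  have := s_lt_s h (by
    rintro ⟨h1, h2⟩
    rw [h1, h2] at hkl
    rcases hkl with hkl | hkl
    · exact hr hkl.1.symm
    · exact hc hkl.1.symm)
  rwa [s_involutive, s_involutive] at this

/-- Consecutive entries in one row or column occupy neighbouring cells, because a cell between them
would hold an entry between `i` and `i + 1`. Otherwise one lies strictly north-east of the other,
and no monotonicity condition compares them directly. -/
theorem content_sub_cases (τ : RST μ (n + 1)) (i : Fin n) :
    (content τ i.castSucc - content τ i.succ) ^ 2 = 1 ∨
      (2 ≤ |content τ i.castSucc - content τ i.succ| ∧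
        IsReverseStandard (swapEntries τ i.castSucc i.succ)) := by
  have hi : i.castSucc < i.succ := Fin.castSucc_lt_succ
  have h1 : ¬ ((τ.1 i.castSucc).1.1 ≤ (τ.1 i.succ).1.1 ∧ (τ.1 i.castSucc).1.2 ≤ (τ.1 i.succ).1.2) :=
    fun h' => lt_asymm hi (τ.lt_of_le_of_le h'.1 h'.2 hi.ne)
  have h2 : ¬ ((τ.1 i.succ).1.1 < (τ.1 i.castSucc).1.1 ∧
      (τ.1 i.succ).1.2 < (τ.1 i.castSucc).1.2) :=
    fun h' => absurd (τ.not_both_lt h'.1 h'.2) (by simp)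
  have between : ∀ m, ¬ (i.castSucc < m ∧ m < i.succ) := by
    rintro m ⟨ha, hb⟩
    simp only [Fin.lt_def, Fin.val_castSucc, Fin.val_succ] at ha hb
    omega
  by_cases hr : (τ.1 i.castSucc).1.1 = (τ.1 i.succ).1.1
  · left
    have hc : (τ.1 i.castSucc).1.2 = (τ.1 i.succ).1.2 + 1 := by
      by_contra hne
      have h3 : (τ.1 i.succ).1.2 + 1 < (τ.1 i.castSucc).1.2 := by omega
      have hm : ((τ.1 i.castSucc).1.1, (τ.1 i.succ).1.2 + 1) ∈ μ.cells :=
        μ.up_left_mem le_rfl h3.le (τ.1 i.castSucc).2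
      have e := τ.1.apply_symm_apply ⟨_, hm⟩
      exact between (τ.1.symm ⟨_, hm⟩) ⟨τ.2 _ _ (Or.inl ⟨by rw [e], by rw [e]; exact h3⟩),
        τ.2 _ _ (Or.inl ⟨by rw [e]; exact hr.symm, by rw [e]; exact Nat.lt_succ_self _⟩)⟩
    simp [content, hr, hc]
  by_cases hc : (τ.1 i.castSucc).1.2 = (τ.1 i.succ).1.2
  · left
    have hr' : (τ.1 i.castSucc).1.1 = (τ.1 i.succ).1.1 + 1 := by
      by_contra hne
      have h3 : (τ.1 i.succ).1.1 + 1 < (τ.1 i.castSucc).1.1 := by omega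
      have hm : ((τ.1 i.succ).1.1 + 1, (τ.1 i.castSucc).1.2) ∈ μ.cells :=
        μ.up_left_mem h3.le le_rfl (τ.1 i.castSucc).2
      have e := τ.1.apply_symm_apply ⟨_, hm⟩
      exact between (τ.1.symm ⟨_, hm⟩) ⟨τ.2 _ _ (Or.inr ⟨by rw [e], by rw [e]; exact h3⟩),
        τ.2 _ _ (Or.inr ⟨by rw [e]; exact hc.symm, by rw [e]; exact Nat.lt_succ_self _⟩)⟩
    simp [content, hr', hc]
  · refine Or.inr ⟨?_, swapEntries_isReverseStandard τ i hr hc⟩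
    simp only [content, le_abs]
    omega

theorem content_ne_succ (τ : RST μ (n + 1)) (i : Fin n) :
    content τ i.castSucc ≠ content τ i.succ :=
  τ.content_ne Fin.castSucc_lt_succ (by simp)

end Tableaux

/-! ## Murphy's operators satisfy the Coxeter relations -/

section Murphy

variable {K : Type*} [Field K] {μ : YoungDiagram} {n : ℕ}

/-- The content of the entry `k` of an arbitrary filling. -/
def fillingContent {N : ℕ} (F : Fin N ≃ {c : ℕ × ℕ // c ∈ μ.cells}) (k : Fin N) : ℤ :=
  ((F k).1.2 : ℤ) - ((F k).1.1 : ℤ)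

/-- The off-diagonal coefficient of Murphy's formula, for the difference of contents `d`. -/
def murphyOffDiag (K : Type*) [Field K] (d : ℤ) : K := if 2 ≤ d then 1 else 1 - ((d : K)⁻¹) ^ 2

/-- The condition for `s_i² = 1` on the `2 × 2` block spanned by a tableau and its exchange. -/
theorem murphyOffDiag_mul_neg [CharZero K] {d : ℤ} (hd : d ≠ 0) :
    murphyOffDiag K d * murphyOffDiag K (-d) = 1 - ((d : K)⁻¹) ^ 2 := by
  simp only [murphyOffDiag]
  split_ifs with h1 h2 h2
  · omega
  · simp [inv_neg]
  · simp
  · have : d = 1 ∨ d = -1 := by omega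
    rcases this with rfl | rfl <;> simp

/-- Murphy's formula on the space spanned by all fillings. -/
def fillingMurphyVec (K : Type*) [Field K] (i : Fin n)
    (F : Fin (n + 1) ≃ {c : ℕ × ℕ // c ∈ μ.cells}) :
    (Fin (n + 1) ≃ {c : ℕ × ℕ // c ∈ μ.cells}) →₀ K :=
  ((fillingContent F i.castSucc - fillingContent F i.succ : ℤ) : K)⁻¹ • Finsupp.single F 1 +
    murphyOffDiag K (fillingContent F i.castSucc - fillingContent F i.succ) •
      Finsupp.single ((s i).trans F) 1

/-- The operator given by Murphy's formula on the space spanned by all fillings. -/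
def fillingMurphy (K : Type*) [Field K] (μ : YoungDiagram) (i : Fin n) :
    Module.End K ((Fin (n + 1) ≃ {c : ℕ × ℕ // c ∈ μ.cells}) →₀ K) :=
  Finsupp.linearCombination K (fillingMurphyVec K i)

/-- The inclusion of `V_μ` into the space spanned by all fillings. -/
def toFilling (K : Type*) [Field K] (μ : YoungDiagram) (n : ℕ) :
    V K μ n →ₗ[K] (Fin (n + 1) ≃ {c : ℕ × ℕ // c ∈ μ.cells}) →₀ K :=
  Finsupp.lmapDomain K K Subtype.val

theorem toFilling_injective : Function.Injective (toFilling K μ n) :=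
  Finsupp.mapDomain_injective Subtype.val_injective

theorem toFilling_single (τ : RST μ (n + 1)) (c : K) :
    toFilling K μ n (Finsupp.single τ c) = Finsupp.single τ.1 c :=
  Finsupp.mapDomain_single

theorem fillingMurphy_single (i : Fin n) (F : Fin (n + 1) ≃ {c : ℕ × ℕ // c ∈ μ.cells}) :
    fillingMurphy K μ i (Finsupp.single F 1) =
      ((fillingContent F i.castSucc - fillingContent F i.succ : ℤ) : K)⁻¹ • Finsupp.single F 1 +
      murphyOffDiag K (fillingContent F i.castSucc - fillingContent F i.succ) •
        Finsupp.single ((s i).trans F) 1 := by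
  simp [fillingMurphy, fillingMurphyVec]

theorem bCoeff_cast [CharZero K] (τ : RST μ (n + 1)) (i : Fin n) :
    (bCoeff τ i : K) = ((content τ i.castSucc - content τ i.succ : ℤ) : K)⁻¹ := by
  simp [bCoeff]

theorem bCoeff_sq_eq_one_iff (τ : RST μ (n + 1)) (i : Fin n) :
    bCoeff τ i ^ 2 = 1 ↔ (content τ i.castSucc - content τ i.succ) ^ 2 = 1 := by
  rw [bCoeff, one_div, inv_pow, inv_eq_one]
  norm_cast

theorem bCoeff_pos_le_iff (τ : RST μ (n + 1)) (i : Fin n) :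
    (0 < bCoeff τ i ∧ bCoeff τ i ≤ 1 / 2) ↔ 2 ≤ content τ i.castSucc - content τ i.succ := by
  have h : (content τ i.castSucc : ℚ) - (content τ i.succ : ℚ) =
    ((content τ i.castSucc - content τ i.succ : ℤ) : ℚ) := by push_cast; rfl
  rw [bCoeff, h]
  generalize content τ i.castSucc - content τ i.succ = d
  constructor
  · rintro ⟨h1, h2⟩
    have h3 : (0 : ℚ) < d := by simpa using h1
    have := (one_div_le_one_div h3 (by norm_num)).1 h2
    exact_mod_cast this
  · intro h
    have h' : (2 : ℚ) ≤ d := by exact_mod_cast h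
    exact ⟨by positivity, one_div_le_one_div_of_le (by norm_num) h'⟩

theorem murphyOffDiag_eq_zero [CharZero K] {d : ℤ} (h : d ^ 2 = 1) : murphyOffDiag K d = 0 := by
  have h2 : ¬ 2 ≤ d := by intro h; nlinarith
  have h0 : (d : K) ^ 2 = 1 := by exact_mod_cast h
  simp [murphyOffDiag, h2, h0]

theorem murphyVec_eq [CharZero K] (i : Fin n) (τ : RST μ (n + 1)) :
    murphyVec K i τ =
      ((content τ i.castSucc - content τ i.succ : ℤ) : K)⁻¹ • Finsupp.single τ 1 +
        murphyOffDiag K (content τ i.castSucc - content τ i.succ) •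
          swapVec K τ i.castSucc i.succ := by
  rw [← bCoeff_cast, Finsupp.smul_single_one, murphyVec]
  split_ifs with h1 h2
  · rw [murphyOffDiag_eq_zero ((bCoeff_sq_eq_one_iff τ i).1 h1), zero_smul, add_zero]
  · rw [murphyOffDiag, if_pos ((bCoeff_pos_le_iff τ i).1 h2), one_smul]
  · rw [murphyOffDiag, if_neg (mt (bCoeff_pos_le_iff τ i).2 h2), ← bCoeff_cast]

theorem murphy_single (i : Fin n) (τ : RST μ (n + 1)) :
    murphy K μ i (Finsupp.single τ 1) = murphyVec K i τ := by
  simp [murphy]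

/-- `τ^{(k,l)}` as a tableau, when it is one. -/
def swapTab (τ : RST μ (n + 1)) (k l : Fin (n + 1)) (h : IsReverseStandard (swapEntries τ k l)) :
    RST μ (n + 1) := ⟨swapEntries τ k l, h⟩

theorem swapVec_eq_single (K : Type*) [Field K] {τ : RST μ (n + 1)} {k l : Fin (n + 1)}
    (h : IsReverseStandard (swapEntries τ k l)) :
    swapVec K τ k l = Finsupp.single (swapTab τ k l h) 1 := by
  rw [swapVec, dif_pos h]
  rfl

/-- Among all fillings the exchanged filling always exists, which removes the case distinctions.
Where it is not standard, the contents differ by one and its coefficient is zero. -/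
theorem toFilling_murphy [CharZero K] (i : Fin n) (t : V K μ n) :
    toFilling K μ n (murphy K μ i t) = fillingMurphy K μ i (toFilling K μ n t) := by
  suffices h : toFilling K μ n ∘ₗ murphy K μ i = fillingMurphy K μ i ∘ₗ toFilling K μ n from
    LinearMap.congr_fun h t
  ext1 τ
  ext1
  simp only [LinearMap.comp_apply, Finsupp.lsingle_apply, toFilling_single, fillingMurphy_single,
    murphy_single, murphyVec_eq, map_add, map_smul]
  change _ = ((content τ i.castSucc - content τ i.succ : ℤ) : K)⁻¹ • Finsupp.single τ.1 1 +
    murphyOffDiag K (content τ i.castSucc - content τ i.succ) •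
      Finsupp.single (swapEntries τ i.castSucc i.succ) 1
  congr 1
  rcases content_sub_cases τ i with h | ⟨-, h⟩
  · rw [murphyOffDiag_eq_zero h, zero_smul, zero_smul]
  · rw [swapVec_eq_single K h, toFilling_single]
    rfl

theorem fillingContent_trans (π : Equiv.Perm (Fin (n + 1)))
    (F : Fin (n + 1) ≃ {c : ℕ × ℕ // c ∈ μ.cells}) (k : Fin (n + 1)) :
    fillingContent (π.trans F) k = fillingContent F (π k) := rfl

/-- The relations are tested on standard tableaux only: in a general filling the contents involved
may coincide. -/
theorem eq_of_single {f g : Module.End K (V K μ n)}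
    (h : ∀ τ : RST μ (n + 1), toFilling K μ n (f (Finsupp.single τ 1)) =
      toFilling K μ n (g (Finsupp.single τ 1))) : f = g := by
  ext1 τ
  ext1
  exact toFilling_injective (h τ)

theorem murphy_mul_self [CharZero K] (i : Fin n) :
    (murphy K μ i : Module.End K (V K μ n)) * murphy K μ i = 1 := by
  apply eq_of_single
  intro τ
  simp only [Module.End.mul_apply, Module.End.one_apply, toFilling_murphy, toFilling_single,
    fillingMurphy_single, map_add, map_smul, fillingContent_trans, s_castSucc, s_succ]
  have hd : content τ i.castSucc - content τ i.succ ≠ 0 := sub_ne_zero.2 (content_ne_succ τ i)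
  change fillingContent τ.1 i.castSucc - fillingContent τ.1 i.succ ≠ 0 at hd
  have hb := murphyOffDiag_mul_neg (K := K) hd
  rw [← neg_sub (fillingContent τ.1 i.castSucc), ← Equiv.trans_assoc]
  have hss : (s i).trans (s i) = Equiv.refl _ := s_mul_s i
  rw [hss, Equiv.refl_trans]
  generalize fillingContent τ.1 i.castSucc - fillingContent τ.1 i.succ = d at *
  rw [Int.cast_neg, inv_neg]
  linear_combination (norm := module) hb • (Finsupp.single τ.1 (1 : K))

theorem murphy_comm [CharZero K] {i j : Fin n} (h : i.val + 1 < j.val) :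
    (murphy K μ i : Module.End K (V K μ n)) * murphy K μ j = murphy K μ j * murphy K μ i := by
  apply eq_of_single
  intro τ
  have h1 : s i j.castSucc = j.castSucc := s_of_ne (by simp [Fin.ext_iff]; omega)
    (by simp [Fin.ext_iff]; omega)
  have h2 : s i j.succ = j.succ := s_of_ne (by simp [Fin.ext_iff]; omega)
    (by simp [Fin.ext_iff]; omega)
  have h3 : s j i.castSucc = i.castSucc := s_of_ne (by simp [Fin.ext_iff]; omega)
    (by simp [Fin.ext_iff]; omega)
  have h4 : s j i.succ = i.succ := s_of_ne (by simp [Fin.ext_iff]; omega)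
    (by simp [Fin.ext_iff]; omega)
  simp only [Module.End.mul_apply, toFilling_murphy, toFilling_single,
    fillingMurphy_single, map_add, map_smul, fillingContent_trans, h1, h2, h3, h4]
  rw [← Equiv.trans_assoc, ← Equiv.trans_assoc]
  have hss : (s i).trans (s j) = (s j).trans (s i) := (s_comm h).symm
  rw [hss]
  module

theorem murphy_braid [CharZero K] {i j : Fin n} (h : j.val = i.val + 1) :
    (murphy K μ i : Module.End K (V K μ n)) * murphy K μ j * murphy K μ i =
      murphy K μ j * murphy K μ i * murphy K μ j := by
  apply eq_of_single
  intro τ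
  have e : j.castSucc = i.succ := by ext; simp [h]
  have h1 : s i j.succ = j.succ := s_of_ne (by simp [Fin.ext_iff]; omega)
    (by simp [Fin.ext_iff]; omega)
  have h2 : s j i.castSucc = i.castSucc := s_of_ne (by simp [Fin.ext_iff]; omega)
    (by simp [Fin.ext_iff]; omega)
  have h3 : s j i.succ = j.succ := by rw [← e, s_castSucc]
  have h4 : s j j.succ = i.succ := by rw [← e, s_succ]
  have d1 : fillingContent τ.1 i.castSucc - fillingContent τ.1 i.succ ≠ 0 :=
    sub_ne_zero.2 (τ.content_ne Fin.castSucc_lt_succ (by simp))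
  have d2 : fillingContent τ.1 i.succ - fillingContent τ.1 j.succ ≠ 0 :=
    sub_ne_zero.2 (τ.content_ne (by simp [Fin.lt_def, h]) (by simp; omega))
  have d3 : fillingContent τ.1 i.castSucc - fillingContent τ.1 j.succ ≠ 0 :=
    sub_ne_zero.2 (τ.content_ne (by simp [Fin.lt_def]; omega) (by simp; omega))
  have b1 := murphyOffDiag_mul_neg (K := K) d1
  have b2 := murphyOffDiag_mul_neg (K := K) d2
  rw [neg_sub] at b1 b2
  simp only [Module.End.mul_apply, toFilling_murphy, toFilling_single,
    fillingMurphy_single, map_add, map_smul, fillingContent_trans, e, h1, h2, h3, h4, s_castSucc,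
    s_succ]
  simp only [← Equiv.trans_assoc]
  have hbr : ((s i).trans (s j)).trans (s i) = ((s j).trans (s i)).trans (s j) := by
    have := s_braid h
    rwa [mul_assoc, mul_assoc] at this
  have hi : (s i).trans (s i) = Equiv.refl _ := s_mul_s i
  have hj : (s j).trans (s j) = Equiv.refl _ := s_mul_s j
  rw [hbr, hi, hj, Equiv.refl_trans]
  set c1 := fillingContent τ.1 i.castSucc
  set c2 := fillingContent τ.1 i.succ
  set c3 := fillingContent τ.1 j.succ
  have n1 : ((c2 - c1 : ℤ) : K)⁻¹ = -((c1 - c2 : ℤ) : K)⁻¹ := by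
    rw [← neg_sub c1 c2, Int.cast_neg, inv_neg]
  have n2 : ((c3 - c2 : ℤ) : K)⁻¹ = -((c2 - c3 : ℤ) : K)⁻¹ := by
    rw [← neg_sub c2 c3, Int.cast_neg, inv_neg]
  -- The rational Yang–Baxter identity. With the two products `b1` and `b2`, it settles the six
  -- coefficients compared below.
  have hxyz : ((c1 - c2 : ℤ) : K)⁻¹ * ((c2 - c3 : ℤ) : K)⁻¹ = ((c1 - c3 : ℤ) : K)⁻¹ *
      (((c1 - c2 : ℤ) : K)⁻¹ + ((c2 - c3 : ℤ) : K)⁻¹) := by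
    have e1 : ((c1 - c2 : ℤ) : K) ≠ 0 := Int.cast_ne_zero.2 d1
    have e2 : ((c2 - c3 : ℤ) : K) ≠ 0 := Int.cast_ne_zero.2 d2
    have e3 : ((c1 - c3 : ℤ) : K) ≠ 0 := Int.cast_ne_zero.2 d3
    field_simp
    push_cast
    ring
  rw [n1, n2]
  generalize ((c1 - c2 : ℤ) : K)⁻¹ = x at *
  generalize ((c2 - c3 : ℤ) : K)⁻¹ = y at *
  generalize ((c1 - c3 : ℤ) : K)⁻¹ = z at *
  match_scalars
  · linear_combination z * b1 - z * b2 + (x - y) * hxyz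
  · linear_combination murphyOffDiag K (c1 - c2) * hxyz
  · linear_combination -murphyOffDiag K (c2 - c3) * hxyz
  · ring
  · ring
  · ring

end Murphy

/-! ## The action of the symmetric group on `V_μ` -/

section TabAct

variable {K : Type*} [Field K] {μ : YoungDiagram} {n : ℕ}

/-- Operators act on the right, so words multiply in the opposite of the endomorphism ring, where
`descentProd_wordProd` applies. -/
theorem wordAct_eq_unop (w : List (Fin n)) :
    wordAct K μ w =
      (w.map fun i => MulOpposite.op (murphy K μ i : Module.End K (V K μ n))).prod.unop := by
  suffices h : ∀ g : Module.End K (V K μ n), w.foldl (fun f i => murphy K μ i ∘ₗ f) g =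
      (w.map fun i => MulOpposite.op (murphy K μ i : Module.End K (V K μ n))).prod.unop * g by
    exact (h 1).trans (mul_one _)
  induction w with
  | nil => intro g; rfl
  | cons i w ih =>
    intro g
    rw [List.foldl_cons, ih, List.map_cons, List.prod_cons, MulOpposite.unop_mul,
      MulOpposite.unop_op, mul_assoc]
    rfl

variable [CharZero K]

theorem wordAct_eq_descentProd (w : List (Fin n)) :
    wordAct K μ w = (descentProd (fun i => MulOpposite.op (murphy K μ i : Module.End K (V K μ n)))
      (wordProd w)).unop := by
  rw [wordAct_eq_unop, descentProd_wordProd]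
  · intro i
    rw [← MulOpposite.op_mul, murphy_mul_self, MulOpposite.op_one]
  · intro i j h
    rw [← MulOpposite.op_mul, ← MulOpposite.op_mul, murphy_comm h]
  · intro i j h
    simp only [← MulOpposite.op_mul, ← mul_assoc, murphy_braid h]

theorem tabAct_wordProd (w : List (Fin n)) : tabAct K μ (wordProd w) = wordAct K μ w := by
  rw [tabAct, wordAct_eq_descentProd, wordAct_eq_descentProd w, wordProd_reducedWord]

theorem tabAct_one (t : V K μ n) : tabAct K μ 1 t = t := by
  have := tabAct_wordProd (K := K) (μ := μ) (n := n) []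
  exact LinearMap.congr_fun this t

theorem tabAct_mul (σ π : Equiv.Perm (Fin (n + 1))) (t : V K μ n) :
    tabAct K μ (σ * π) t = tabAct K μ π (tabAct K μ σ t) := by
  have h : wordProd (reducedWord σ ++ reducedWord π) = σ * π := by
    rw [wordProd, List.map_append, List.prod_append]
    exact congrArg₂ (· * ·) (wordProd_reducedWord σ) (wordProd_reducedWord π)
  rw [← h, tabAct_wordProd, wordAct_eq_unop, List.map_append, List.prod_append,
    MulOpposite.unop_mul, ← wordAct_eq_unop, ← wordAct_eq_unop]
  rfl

theorem tabAct_inv_apply (σ : Equiv.Perm (Fin (n + 1))) (t : V K μ n) :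
    tabAct K μ σ (tabAct K μ σ⁻¹ t) = t := by
  rw [← tabAct_mul, inv_mul_cancel, tabAct_one]

theorem tabAct_apply_inv (σ : Equiv.Perm (Fin (n + 1))) (t : V K μ n) :
    tabAct K μ σ⁻¹ (tabAct K μ σ t) = t := by
  rw [← tabAct_mul, mul_inv_cancel, tabAct_one]

theorem tabAct_swap_swap (σ : Equiv.Perm (Fin (n + 1))) (i j : Fin (n + 1)) (t : V K μ n) :
    tabAct K μ (Equiv.swap i j) (tabAct K μ σ t) =
      tabAct K μ σ (tabAct K μ (Equiv.swap (σ i) (σ j)) t) := by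
  rw [← tabAct_mul, ← tabAct_mul, Equiv.mul_swap_eq_swap_mul]

/-! ### Jucys–Murphy elements act by contents -/

theorem content_last (τ : RST μ (n + 1)) : content τ (Fin.last n) = 0 := by
  have hm : (0, 0) ∈ μ.cells := μ.up_left_mem (Nat.zero_le _) (Nat.zero_le _) (τ.1 0).2
  have e := τ.1.apply_symm_apply ⟨_, hm⟩
  have h : τ.1.symm ⟨_, hm⟩ = Fin.last n := by
    by_contra hne
    have := τ.lt_of_le_of_le (k := τ.1.symm ⟨_, hm⟩) (l := Fin.last n) (by rw [e]; simp)
      (by rw [e]; simp) hne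
    exact absurd this (not_lt.2 (Fin.le_last _))
  rw [h] at e
  simp [content, e]

/-- The Jucys–Murphy element `∑_{j > k} s_{kj}`. -/
def jucysMurphy (K : Type*) [Field K] (μ : YoungDiagram) (k : Fin (n + 1)) :
    V K μ n →ₗ[K] V K μ n :=
  ∑ j ∈ Finset.Ioi k, tabAct K μ (Equiv.swap k j)

/-- Conjugation by `s_i` turns `s_{i+1,j}` into `s_{i,j}` for `j > i + 1`; the term `j = i + 1` is
`s_i` itself. -/
theorem jucysMurphy_castSucc (i : Fin n) (t : V K μ n) :
    jucysMurphy K μ i.castSucc t =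
      murphy K μ i (jucysMurphy K μ i.succ (murphy K μ i t)) + murphy K μ i t := by
  have h : Finset.Ioi i.castSucc = insert i.succ (Finset.Ioi i.succ) := by
    ext k
    simp only [Finset.mem_Ioi, Finset.mem_insert, Fin.lt_def, Fin.ext_iff, Fin.val_castSucc,
      Fin.val_succ]
    omega
  simp only [jucysMurphy, LinearMap.sum_apply, map_sum]
  rw [h, Finset.sum_insert (by simp), add_comm, ← tabAct_s]
  congr 1
  refine Finset.sum_congr rfl fun j hj => ?_
  rw [tabAct_swap_swap, s_succ, s_of_ne, ← tabAct_mul (s i) (s i), s_mul_s, tabAct_one]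
  all_goals
    rintro rfl
    simp [Fin.lt_def] at hj

/-- Downward induction from the largest entry, whose content is `0`. The element of `i + 1` has
eigenvalues `c_{i+1}` on `τ` and `c_i` on the exchanged tableau, where `i + 1` sits in the former
cell of `i`. The diagonal coefficient `1/(c_i - c_{i+1})` yields exactly the correction `-τ` in
`key`. -/
theorem jucysMurphy_single (k : Fin (n + 1)) (τ : RST μ (n + 1)) :
    jucysMurphy K μ k (Finsupp.single τ 1) = (content τ k : K) • Finsupp.single τ 1 := by
  induction k using Fin.reverseInduction generalizing τ with
  | last =>
    have h : Finset.Ioi (Fin.last n) = ∅ := Finset.Ioi_eq_empty.2 isMax_top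
    simp [jucysMurphy, content_last, h]
  | cast i ih =>
    have hsw : jucysMurphy K μ i.succ (swapVec K τ i.castSucc i.succ) =
        (content τ i.castSucc : K) • swapVec K τ i.castSucc i.succ := by
      by_cases h : IsReverseStandard (swapEntries τ i.castSucc i.succ)
      · rw [swapVec_eq_single K h, ih]
        congr 2
        change fillingContent τ.1 (s i i.succ) = _
        rw [s_succ]
        rfl
      · simp [swapVec, h]
    have hd : ((content τ i.castSucc - content τ i.succ : ℤ) : K) ≠ 0 :=
      Int.cast_ne_zero.2 (sub_ne_zero.2 (content_ne_succ τ i))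
    have key : jucysMurphy K μ i.succ (murphy K μ i (Finsupp.single τ 1)) =
        (content τ i.castSucc : K) • murphy K μ i (Finsupp.single τ 1) - Finsupp.single τ 1 := by
      rw [murphy_single, murphyVec_eq, map_add, map_smul, map_smul, hsw, ih]
      have e := inv_mul_cancel₀ hd
      nth_rw 2 [Int.cast_sub] at e
      linear_combination (norm := module) -(e • (Finsupp.single τ (1 : K)))
    have hm := LinearMap.congr_fun (murphy_mul_self (K := K) (μ := μ) i) (Finsupp.single τ 1)
    simp only [Module.End.mul_apply, Module.End.one_apply] at hm
    rw [jucysMurphy_castSucc, key, map_sub, map_smul, hm]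
    abel

end TabAct

/-! ## Standardization -/

section Standardization

variable {N : ℕ}

theorem standardization_lt_iff (v : Fin N → ℕ) (i j : Fin N) :
    standardization v i < standardization v j ↔ v j < v i ∨ (v i = v j ∧ i < j) := by
  obtain ⟨h1, h2⟩ := Tuple.eq_sort_iff.1
    (rfl : Tuple.sort (fun i => OrderDual.toDual (v i)) = Tuple.sort _)
  set π := Tuple.sort (fun i => OrderDual.toDual (v i)) with hπ
  have hs : standardization v = π⁻¹ := rfl
  have mono : ∀ a b, a ≤ b → v (π b) ≤ v (π a) := fun a b h => h1 h
  have key : ∀ i j, π⁻¹ i < π⁻¹ j → v j < v i ∨ (v i = v j ∧ i < j) := by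
    intro i j h
    have := mono _ _ h.le
    rw [show π (π⁻¹ i) = i from π.apply_symm_apply i,
      show π (π⁻¹ j) = j from π.apply_symm_apply j] at this
    rcases this.lt_or_eq with h' | h'
    · exact Or.inl h'
    · refine Or.inr ⟨h'.symm, ?_⟩
      have := h2 _ _ h (by simp [h'])
      simpa using this
  rw [hs]
  refine ⟨key i j, fun h => ?_⟩
  rcases lt_trichotomy (π⁻¹ i) (π⁻¹ j) with h' | h' | h'
  · exact h'
  · have : i = j := π⁻¹.injective h'
    subst this
    simp at h
  · have := key _ _ h'
    omega

/-- The composite of `σ_v` with the inverse of `π` is strictly monotone, hence the identity. -/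
theorem eq_standardization {v : Fin N → ℕ} {π : Equiv.Perm (Fin N)}
    (h : ∀ i j, π i < π j → v j < v i ∨ (v i = v j ∧ i < j)) : π = standardization v := by
  have : StrictMono (standardization v * π⁻¹) := by
    intro a b hab
    have := h (π⁻¹ a) (π⁻¹ b) (by simpa using hab)
    exact (standardization_lt_iff v _ _).2 this
  have h1 : standardization v * π⁻¹ = 1 := (Equiv.Perm.monotone_iff _).1 this.monotone
  exact (mul_inv_eq_one.1 h1).symm

theorem standardization_zero : standardization (fun _ : Fin N => 0) = 1 :=
  (eq_standardization fun _ _ h => Or.inr ⟨rfl, h⟩).symm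

variable {n : ℕ}

theorem standardization_comp_s {v : Fin (n + 1) → ℕ} {i : Fin n}
    (h : v i.castSucc ≠ v i.succ) : standardization (v ∘ s i) = standardization v * s i := by
  symm
  apply eq_standardization
  intro a b hab
  rw [Equiv.Perm.mul_apply, Equiv.Perm.mul_apply, standardization_lt_iff] at hab
  rcases hab with hab | ⟨h1, h2⟩
  · exact Or.inl hab
  · refine Or.inr ⟨h1, ?_⟩
    have := s_lt_s h2 (by rintro ⟨h3, h4⟩; rw [h3, h4] at h1; exact h h1)
    rwa [s_involutive, s_involutive] at this

theorem theta_last : theta n (Fin.last n) = 0 := finRotate_last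

theorem theta_val_of_ne {k : Fin (n + 1)} (h : k ≠ Fin.last n) : (theta n k).val = k.val + 1 :=
  coe_finRotate_of_ne_last h

/-- Moving `v[1]` to the end costs it its priority among equal entries; adding `1` restores it. -/
theorem standardization_affineVec (v : Fin (n + 1) → ℕ) :
    standardization (affineVec 1 v) = standardization v * theta n := by
  symm
  apply eq_standardization
  intro a b hab
  rw [Equiv.Perm.mul_apply, Equiv.Perm.mul_apply, standardization_lt_iff] at hab
  simp only [affineVec]
  have hl : ∀ c : Fin (n + 1), c ≠ Fin.last n → c.val < n := fun c hc =>
    lt_of_le_of_ne (Nat.lt_succ_iff.1 c.2) fun h => hc (Fin.ext h)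
  by_cases ha : a = Fin.last n <;> by_cases hb : b = Fin.last n
  · subst ha; subst hb; simp at hab
  · subst ha
    rw [if_pos rfl, if_neg hb]
    omega
  · subst hb
    rw [if_neg ha, if_pos rfl]
    rw [theta_last] at *
    simp only [Fin.not_lt_zero, and_false, or_false] at hab
    have := hl a ha
    simp only [Fin.lt_def, Fin.val_last]
    omega
  · rw [if_neg ha, if_neg hb]
    simpa only [Fin.lt_def, theta_val_of_ne ha, theta_val_of_ne hb, Nat.add_lt_add_iff_right]
      using hab

/-- A position numbered in between would carry the same value and lie strictly between `i` and `i +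
1`. -/
theorem standardization_succ {v : Fin (n + 1) → ℕ} {i : Fin n} (h : v i.castSucc = v i.succ) :
    (standardization v i.succ).val = (standardization v i.castSucc).val + 1 := by
  have h1 : standardization v i.castSucc < standardization v i.succ :=
    (standardization_lt_iff v _ _).2 (Or.inr ⟨h, Fin.castSucc_lt_succ⟩)
  by_contra hne
  rw [Fin.lt_def] at h1
  have hlt := (standardization v i.succ).is_lt
  set m : Fin (n + 1) := ⟨(standardization v i.castSucc).val + 1, by omega⟩ with hm
  have e : standardization v ((standardization v)⁻¹ m) = m := by simp
  set k := (standardization v)⁻¹ m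
  have h2 : standardization v i.castSucc < standardization v k := by
    rw [e, Fin.lt_def]; simp [hm]
  have h3 : standardization v k < standardization v i.succ := by
    rw [e, Fin.lt_def]; simp only [hm]; omega
  rw [standardization_lt_iff] at h2 h3
  simp only [Fin.lt_def, Fin.val_castSucc, Fin.val_succ] at h2 h3
  omega

end Standardization

/-! ## The order on vectors -/

section Order

variable {N : ℕ}

theorem DomLE.trans {u v w : Fin N → ℕ} (h1 : DomLE u v) (h2 : DomLE v w) : DomLE u w :=
  fun i => (h1 i).trans (h2 i)

theorem eq_of_sum_Iic_eq {u w : Fin N → ℕ}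
    (h : ∀ i, ∑ j ∈ Finset.Iic i, u j = ∑ j ∈ Finset.Iic i, w j) : u = w := by
  funext i
  induction hi : i.val using Nat.strong_induction_on generalizing i with
  | _ m ih =>
  subst hi
  have e : ∑ j ∈ Finset.Iio i, u j = ∑ j ∈ Finset.Iio i, w j :=
    Finset.sum_congr rfl fun j hj =>
      ih _ (Fin.lt_def.1 (Finset.mem_Iio.1 hj)) j rfl
  have := h i
  rw [← Finset.Iio_insert, Finset.sum_insert (by simp), Finset.sum_insert (by simp), e] at this
  omega

theorem DomLE.antisymm {u w : Fin N → ℕ} (h1 : DomLE u w) (h2 : DomLE w u) : u = w :=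
  eq_of_sum_Iic_eq fun i => (h1 i).antisymm (h2 i)

theorem DomLT.trans {u v w : Fin N → ℕ} (h1 : DomLT u v) (h2 : DomLT v w) : DomLT u w :=
  ⟨h1.1.trans h2.1, fun h => h2.2 (h2.1.antisymm (h ▸ h1.1))⟩

theorem VecLT.trans {u v w : Fin N → ℕ} (h1 : VecLT u v) (h2 : VecLT v w) : VecLT u w := by
  rcases h1 with h1 | ⟨e1, h1⟩ <;> rcases h2 with h2 | ⟨e2, h2⟩
  · exact Or.inl (h1.trans h2)
  · exact Or.inl (e2 ▸ h1)
  · exact Or.inl (e1 ▸ h2)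
  · exact Or.inr ⟨e1.trans e2, h1.trans h2⟩

theorem VecLT.irrefl (u : Fin N → ℕ) : ¬ VecLT u u := by
  rintro (h | h)
  · exact h.2 rfl
  · exact h.2.2 rfl

/-- The sum of the partial sums. -/
def sumPartial (u : Fin N → ℕ) : ℕ := ∑ i, ∑ j ∈ Finset.Iic i, u j

theorem sumPartial_lt {u w : Fin N → ℕ} (h : DomLT u w) : sumPartial u < sumPartial w := by
  apply Finset.sum_lt_sum (fun i _ => h.1 i)
  by_contra! hc
  exact h.2 (eq_of_sum_Iic_eq fun i => (h.1 i).antisymm (hc i (Finset.mem_univ i)))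

/-- A rank function for `◁`. -/
def vecRank (u : Fin N → ℕ) : ℕ ×ₗ ℕ := toLex (sumPartial (decr u), sumPartial u)

theorem vecRank_lt {u w : Fin N → ℕ} (h : VecLT u w) : vecRank u < vecRank w := by
  rw [vecRank, vecRank, Prod.Lex.toLex_lt_toLex]
  rcases h with h | ⟨e, h⟩
  · exact Or.inl (sumPartial_lt h)
  · exact Or.inr ⟨by rw [e], sumPartial_lt h⟩

theorem VecLT.wellFounded : WellFounded (VecLT : (Fin N → ℕ) → (Fin N → ℕ) → Prop) :=
  Subrelation.wf (fun h => vecRank_lt h) (InvImage.wf vecRank wellFounded_lt)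

theorem exists_vecLT_maximal {S : Finset (Fin N → ℕ)} (h : S.Nonempty) :
    ∃ w ∈ S, ∀ x ∈ S, ¬ VecLT w x := by
  obtain ⟨w, hw, hmax⟩ := S.exists_max_image vecRank h
  exact ⟨w, hw, fun x hx hlt => absurd (vecRank_lt hlt) (not_lt.2 (hmax x hx))⟩

/-- A maximal element among those not below `v` would, by transitivity, be maximal in all of `S`,
hence equal to `v`. -/
theorem eq_or_vecLT_of_maximal {S : Finset (Fin N → ℕ)} {v : Fin N → ℕ}
    (h : ∀ w ∈ S, (∀ x ∈ S, ¬ VecLT w x) → w = v) (u : Fin N → ℕ) (hu : u ∈ S) :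
    u = v ∨ VecLT u v := by
  classical
  by_contra hbad
  obtain ⟨w, hw, hmax⟩ := exists_vecLT_maximal (S := S.filter fun u => ¬ (u = v ∨ VecLT u v))
    ⟨u, Finset.mem_filter.2 ⟨hu, hbad⟩⟩
  rw [Finset.mem_filter] at hw
  refine hw.2 (Or.inl (h w hw.1 fun x hx hwx => ?_))
  by_cases hx' : x = v ∨ VecLT x v
  · rcases hx' with rfl | hx'
    · exact hw.2 (Or.inr hwx)
    · exact hw.2 (Or.inr (hwx.trans hx'))
  · exact hmax x (Finset.mem_filter.2 ⟨hx, hx'⟩) hwx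

/-! ### Rearrangements and criteria for `◁` -/

theorem decr_comp_perm (v : Fin N → ℕ) (π : Equiv.Perm (Fin N)) : decr (v ∘ π) = decr v := by
  have h := Tuple.comp_perm_comp_sort_eq_comp_sort (f := fun i => OrderDual.toDual (v i)) (σ := π)
  exact h

theorem decr_antitone (v : Fin N → ℕ) : Antitone (decr v) :=
  Tuple.monotone_sort fun i => OrderDual.toDual (v i)

/-- The two differences `T \ Iic i` and `Iic i \ T` have the same size, and `g i` separates the
values on them. -/
theorem sum_le_sum_Iic_of_antitone {g : Fin N → ℕ} (hg : Antitone g) (i : Fin N)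
    {T : Finset (Fin N)} (hT : T.card = (Finset.Iic i).card) :
    ∑ j ∈ T, g j ≤ ∑ j ∈ Finset.Iic i, g j := by
  classical
  rw [← Finset.sum_sdiff (Finset.inter_subset_left (s₁ := T) (s₂ := Finset.Iic i)),
    ← Finset.sum_sdiff (Finset.inter_subset_right (s₁ := T) (s₂ := Finset.Iic i))]
  refine Nat.add_le_add_right ?_ _
  rw [Finset.sdiff_inter_self_left, Finset.sdiff_inter_self_right]
  have hc : (T \ Finset.Iic i).card = (Finset.Iic i \ T).card := Finset.card_sdiff_comm hT
  calc ∑ j ∈ T \ Finset.Iic i, g j ≤ (T \ Finset.Iic i).card • g i := by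
        refine Finset.sum_le_card_nsmul _ _ _ fun j hj => hg ?_
        simp only [Finset.mem_sdiff, Finset.mem_Iic, not_le] at hj
        exact hj.2.le
    _ = (Finset.Iic i \ T).card • g i := by rw [hc]
    _ ≤ ∑ j ∈ Finset.Iic i \ T, g j := by
        refine Finset.card_nsmul_le_sum _ _ _ fun j hj => hg ?_
        simp only [Finset.mem_sdiff, Finset.mem_Iic] at hj
        exact hj.1

/-- Partial sums of the decreasing rearrangement are the largest sums over subsets of the given
size. -/
theorem domLE_decr {u w : Fin N → ℕ}
    (h : ∀ S : Finset (Fin N), ∃ T : Finset (Fin N), T.card = S.card ∧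
      ∑ j ∈ S, u j ≤ ∑ j ∈ T, w j) : DomLE (decr u) (decr w) := by
  intro i
  obtain ⟨T, hT, hle⟩ := h ((Finset.Iic i).map (standardization u)⁻¹.toEmbedding)
  rw [Finset.card_map] at hT
  rw [Finset.sum_map] at hle
  refine hle.trans ?_
  have e : ∑ j ∈ T, w j = ∑ j ∈ T.map (standardization w).toEmbedding, decr w j := by
    rw [Finset.sum_map]
    refine Finset.sum_congr rfl fun j _ => ?_
    exact congrArg w ((standardization w).symm_apply_apply j).symm
  rw [e]
  exact sum_le_sum_Iic_of_antitone (decr_antitone w) i (by rw [Finset.card_map, hT])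

theorem sum_decr_sq (v : Fin N → ℕ) : ∑ k, decr v k ^ 2 = ∑ k, v k ^ 2 :=
  Equiv.sum_comp (standardization v)⁻¹ fun k => v k ^ 2

/-- The vector obtained from `v` by putting `c` at position `i` and `d` at position `j`. -/
def update₂ (v : Fin N → ℕ) (i j : Fin N) (c d : ℕ) : Fin N → ℕ :=
  Function.update (Function.update v i c) j d

theorem update₂_left (v : Fin N → ℕ) {i j : Fin N} (h : i ≠ j) (c d : ℕ) :
    update₂ v i j c d i = c := by simp [update₂, h]

theorem update₂_right (v : Fin N → ℕ) (i j : Fin N) (c d : ℕ) : update₂ v i j c d j = d := by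
  simp [update₂]

theorem update₂_of_ne (v : Fin N → ℕ) {i j k : Fin N} (hi : k ≠ i) (hj : k ≠ j) (c d : ℕ) :
    update₂ v i j c d k = v k := by simp [update₂, hi, hj]

theorem update₂_self (v : Fin N → ℕ) {i j : Fin N} : update₂ v i j (v i) (v j) = v := by
  simp [update₂]

theorem update₂_swap (v : Fin N → ℕ) {i j : Fin N} (h : i ≠ j) :
    update₂ v i j (v j) (v i) = v ∘ Equiv.swap i j := by
  funext k
  by_cases hi : k = i
  · subst hi; simp [update₂_left v h]
  by_cases hj : k = j
  · subst hj; simp [update₂_right]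
  · simp [update₂_of_ne v hi hj, Equiv.swap_apply_of_ne_of_ne hi hj]

theorem sum_eq_add_add {ι R : Type*} [DecidableEq ι] [AddCommMonoid R] {S : Finset ι} (f : ι → R)
    {i j : ι} (hi : i ∈ S) (hj : j ∈ S) (h : i ≠ j) :
    ∑ k ∈ S, f k = f i + f j + ∑ k ∈ (S.erase i).erase j, f k := by
  rw [add_assoc, Finset.add_sum_erase _ f (Finset.mem_erase.2 ⟨h.symm, hj⟩),
    Finset.add_sum_erase _ f hi]

/-- Moving two entries towards each other with fixed sum cannot raise the largest subset sums. It
strictly lowers the sum of squares, so the rearrangement does change. -/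
theorem update₂_vecLT {v : Fin N → ℕ} {i j : Fin N} (h : i ≠ j) {c d : ℕ}
    (hs : c + d = v i + v j) (hc : min (v i) (v j) < c) (hd : min (v i) (v j) < d) :
    VecLT (update₂ v i j c d) v := by
  left
  have hrest : ∀ S : Finset (Fin N), i ∉ S → j ∉ S →
      ∑ k ∈ S, update₂ v i j c d k = ∑ k ∈ S, v k := by
    intro S hi hj
    refine Finset.sum_congr rfl fun k hk => update₂_of_ne v ?_ ?_ c d
    · rintro rfl; exact hi hk
    · rintro rfl; exact hj hk
  refine ⟨domLE_decr fun S => ?_, fun heq => ?_⟩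
  · by_cases hi : i ∈ S <;> by_cases hj : j ∈ S
    · refine ⟨S, rfl, ?_⟩
      rw [sum_eq_add_add _ hi hj h, sum_eq_add_add v hi hj h, update₂_left v h, update₂_right,
        hrest _ (by simp) (by simp), hs]
    · have hi' : i ∉ S.erase i := by simp
      have hj' : j ∉ S.erase i := by simp [hj]
      rw [← Finset.add_sum_erase _ _ hi, update₂_left v h, hrest _ hi' hj']
      rcases le_total (v i) (v j) with hle | hle
      -- Here `v j` is the larger of the two entries and exceeds `c`, so `i` is traded for `j`.
      · refine ⟨insert j (S.erase i), ?_, ?_⟩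
        · rw [Finset.card_insert_of_notMem hj', Finset.card_erase_add_one hi]
        · rw [Finset.sum_insert hj']
          omega
      · refine ⟨S, rfl, ?_⟩
        rw [← Finset.add_sum_erase _ v hi]
        omega
    · have hi' : i ∉ S.erase j := by simp [hi]
      have hj' : j ∉ S.erase j := by simp
      rw [← Finset.add_sum_erase _ _ hj, update₂_right, hrest _ hi' hj']
      rcases le_total (v i) (v j) with hle | hle
      · refine ⟨S, rfl, ?_⟩
        rw [← Finset.add_sum_erase _ v hj]
        omega
      · refine ⟨insert i (S.erase j), ?_, ?_⟩
        · rw [Finset.card_insert_of_notMem hi', Finset.card_erase_add_one hj]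
        · rw [Finset.sum_insert hi']
          omega
    · exact ⟨S, rfl, (hrest S hi hj).le⟩
  · have hsq := sum_decr_sq (update₂ v i j c d)
    rw [heq, sum_decr_sq, sum_eq_add_add _ (Finset.mem_univ i) (Finset.mem_univ j) h,
      sum_eq_add_add (fun k => update₂ v i j c d k ^ 2) (Finset.mem_univ i) (Finset.mem_univ j) h,
      update₂_left v h, update₂_right] at hsq
    have hr : ∑ k ∈ (Finset.univ.erase i).erase j, update₂ v i j c d k ^ 2 =
        ∑ k ∈ (Finset.univ.erase i).erase j, v k ^ 2 := by
      refine Finset.sum_congr rfl fun k hk => ?_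
      simp only [Finset.mem_erase] at hk
      rw [update₂_of_ne v hk.2.1 hk.1]
    rw [hr] at hsq
    have hsq : v i ^ 2 + v j ^ 2 = c ^ 2 + d ^ 2 := by omega
    rcases le_total (v i) (v j) with hle | hle
    · rw [min_eq_left hle] at hc hd
      obtain ⟨x, rfl⟩ := Nat.exists_eq_add_of_lt hc
      obtain ⟨y, rfl⟩ := Nat.exists_eq_add_of_lt hd
      have : v j = v i + x + y + 2 := by omega
      rw [this] at hsq
      nlinarith
    · rw [min_eq_right hle] at hc hd
      obtain ⟨x, rfl⟩ := Nat.exists_eq_add_of_lt hc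
      obtain ⟨y, rfl⟩ := Nat.exists_eq_add_of_lt hd
      have : v i = v j + x + y + 2 := by omega
      rw [this] at hsq
      nlinarith

theorem comp_swap_vecLT {v : Fin N → ℕ} {i j : Fin N} (hij : i < j) (hv : v j < v i) :
    VecLT (v ∘ Equiv.swap i j) v := by
  refine Or.inr ⟨decr_comp_perm v _, fun m => ?_, fun h => ?_⟩
  · rcases lt_or_ge m j with hm | hm
    · refine Finset.sum_le_sum fun k hk => ?_
      rw [Finset.mem_Iic] at hk
      have hkj : k ≠ j := (hk.trans_lt hm).ne
      by_cases hki : k = i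
      · subst hki; simp [hv.le]
      · simp [Equiv.swap_apply_of_ne_of_ne hki hkj]
    · refine le_of_eq (Finset.sum_equiv (Equiv.swap i j) (fun k => ?_) fun _ _ => rfl)
      simp only [Finset.mem_Iic]
      rw [Equiv.swap_apply_def]
      split_ifs with h1 h2
      · subst h1; exact iff_of_true (hij.le.trans hm) hm
      · subst h2; exact iff_of_true hm (hij.le.trans hm)
      · rfl
  · have := congrFun h i
    simp at this
    omega

end Order

/-! ## Commutation relations -/

section Operators

open MvPolynomial

variable {K : Type*} [Field K] {μ : YoungDiagram} {n : ℕ}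

theorem polyAct_mul (σ : Equiv.Perm (Fin (n + 1))) (p q : MvPolynomial (Fin (n + 1)) K) :
    polyAct K σ (p * q) = polyAct K σ p * polyAct K σ q := map_mul (rename _) p q

theorem polyAct_X (σ : Equiv.Perm (Fin (n + 1))) (k : Fin (n + 1)) :
    polyAct K σ (X k) = X (σ⁻¹ k) := rename_X _ _

theorem polyAct_mul_perm (σ π : Equiv.Perm (Fin (n + 1))) (p : MvPolynomial (Fin (n + 1)) K) :
    polyAct K (σ * π) p = polyAct K π (polyAct K σ p) := by
  simp only [polyAct, AlgHom.toLinearMap_apply, rename_rename]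
  rfl

theorem polyAct_one (p : MvPolynomial (Fin (n + 1)) K) : polyAct K 1 p = p := by
  simp [polyAct, Equiv.Perm.one_def]

theorem polyAct_swap_swap (σ : Equiv.Perm (Fin (n + 1))) (i j : Fin (n + 1))
    (p : MvPolynomial (Fin (n + 1)) K) : polyAct K (Equiv.swap i j) (polyAct K σ p) =
      polyAct K σ (polyAct K (Equiv.swap (σ i) (σ j)) p) := by
  rw [← polyAct_mul_perm, ← polyAct_mul_perm, Equiv.mul_swap_eq_swap_mul]

theorem X_mul_polyAct (σ : Equiv.Perm (Fin (n + 1))) (i : Fin (n + 1))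
    (p : MvPolynomial (Fin (n + 1)) K) : X i * polyAct K σ p = polyAct K σ (X (σ i) * p) := by
  rw [polyAct_mul, polyAct_X]
  congr 2
  exact (σ.symm_apply_apply i).symm

theorem pderiv_polyAct (σ : Equiv.Perm (Fin (n + 1))) (i : Fin (n + 1))
    (p : MvPolynomial (Fin (n + 1)) K) :
    pderiv i (polyAct K σ p) = polyAct K σ (pderiv (σ i) p) := by
  have h := pderiv_rename (R := K) (σ⁻¹ : Equiv.Perm (Fin (n + 1))).injective (σ i) p
  rw [show (σ⁻¹ : Equiv.Perm (Fin (n + 1))) (σ i) = i from σ.symm_apply_apply i] at h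
  exact h

/-- The divided difference `∂_{ij}`, extended by `0` to `i = j`. -/
def divDiff₀ (K : Type*) [Field K] (i j : Fin (n + 1)) :
    MvPolynomial (Fin (n + 1)) K →ₗ[K] MvPolynomial (Fin (n + 1)) K :=
  if h : i ≠ j then divDiff K i j h else 0

theorem divDiff₀_self (i : Fin (n + 1)) : divDiff₀ K i i = 0 := by simp [divDiff₀]

theorem divDiff₀_of_ne {i j : Fin (n + 1)} (h : i ≠ j) : divDiff₀ K i j = divDiff K i j h := by
  simp [divDiff₀, h]

theorem mul_divDiff₀ (i j : Fin (n + 1)) (p : MvPolynomial (Fin (n + 1)) K) :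
    (X i - X j) * divDiff₀ K i j p = p - polyAct K (Equiv.swap i j) p := by
  by_cases h : i = j
  · subst h
    rw [sub_self, zero_mul, Equiv.swap_self]
    exact (sub_eq_zero.2 (polyAct_one p).symm).symm
  · rw [divDiff₀_of_ne h, mul_divDiff]

theorem eq_divDiff₀ {i j : Fin (n + 1)} (h : i ≠ j) {p q : MvPolynomial (Fin (n + 1)) K}
    (hq : (X i - X j) * q = p - polyAct K (Equiv.swap i j) p) : divDiff₀ K i j p = q :=
  mul_left_cancel₀ (X_sub_X_ne_zero h) (by rw [hq, mul_divDiff₀])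

theorem divDiff₀_polyAct (σ : Equiv.Perm (Fin (n + 1))) (i j : Fin (n + 1))
    (p : MvPolynomial (Fin (n + 1)) K) :
    divDiff₀ K i j (polyAct K σ p) = polyAct K σ (divDiff₀ K (σ i) (σ j) p) := by
  by_cases h : i = j
  · subst h; simp [divDiff₀_self]
  · apply eq_divDiff₀ h
    rw [sub_mul, X_mul_polyAct, X_mul_polyAct, ← map_sub, ← sub_mul, mul_divDiff₀, map_sub,
      polyAct_swap_swap]

theorem divDiff₀_X_mul_of_ne {i j k : Fin (n + 1)} (hi : k ≠ i) (hj : k ≠ j)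
    (p : MvPolynomial (Fin (n + 1)) K) :
    divDiff₀ K i j (X k * p) = X k * divDiff₀ K i j p := by
  by_cases h : i = j
  · subst h; simp [divDiff₀_self]
  · apply eq_divDiff₀ h
    rw [polyAct_mul, polyAct_X, Equiv.swap_inv, Equiv.swap_apply_of_ne_of_ne hi hj, mul_left_comm,
      mul_divDiff₀, mul_sub]

theorem divDiff₀_X_right_mul {i j : Fin (n + 1)} (h : i ≠ j) (p : MvPolynomial (Fin (n + 1)) K) :
    divDiff₀ K i j (X j * p) = X j * divDiff₀ K i j p - polyAct K (Equiv.swap i j) p := by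
  apply eq_divDiff₀ h
  rw [polyAct_mul, polyAct_X, Equiv.swap_inv, Equiv.swap_apply_right, mul_sub, mul_left_comm,
    mul_divDiff₀]
  ring

theorem divDiff₀_X_left_mul {i j : Fin (n + 1)} (h : i ≠ j) (p : MvPolynomial (Fin (n + 1)) K) :
    divDiff₀ K i j (X i * p) = X i * divDiff₀ K i j p + polyAct K (Equiv.swap i j) p := by
  apply eq_divDiff₀ h
  rw [polyAct_mul, polyAct_X, Equiv.swap_inv, Equiv.swap_apply_left, mul_add, mul_left_comm,
    mul_divDiff₀]
  ring

theorem diagAct_tmul (σ : Equiv.Perm (Fin (n + 1))) (p : MvPolynomial (Fin (n + 1)) K)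
    (t : V K μ n) : diagAct K μ σ (p ⊗ₜ t) = polyAct K σ p ⊗ₜ tabAct K μ σ t := rfl

theorem mulX_tmul (i : Fin (n + 1)) (p : MvPolynomial (Fin (n + 1)) K)
    (t : V K μ n) : mulX K μ i (p ⊗ₜ t) = (X i * p) ⊗ₜ t := rfl

theorem ext_tmul {f g : M K μ n →ₗ[K] M K μ n} (h : ∀ p t, f (p ⊗ₜ t) = g (p ⊗ₜ t)) (P : M K μ n) :
    f P = g P :=
  LinearMap.congr_fun (TensorProduct.ext' h) P

theorem diagAct_mulX (σ : Equiv.Perm (Fin (n + 1))) (i : Fin (n + 1)) (P : M K μ n) :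
    diagAct K μ σ (mulX K μ (σ i) P) = mulX K μ i (diagAct K μ σ P) := by
  refine ext_tmul (f := diagAct K μ σ ∘ₗ mulX K μ (σ i)) (g := mulX K μ i ∘ₗ diagAct K μ σ) ?_ P
  intro p t
  simp only [LinearMap.comp_apply, mulX_tmul, diagAct_tmul, X_mul_polyAct]

/-- The operator `x_i (α D_i)`, where multiplication by `x_i` is applied first. -/
def cherednikY (μ : YoungDiagram) (α : K) (i : Fin (n + 1)) : M K μ n →ₗ[K] M K μ n :=
  α • TensorProduct.map ((pderiv i).toLinearMap ∘ₗ LinearMap.mulLeft K (X i)) LinearMap.id +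
    ∑ j, TensorProduct.map (divDiff₀ K i j ∘ₗ LinearMap.mulLeft K (X i))
      (tabAct K μ (Equiv.swap i j))

theorem cherednikY_tmul (α : K) (i : Fin (n + 1)) (p : MvPolynomial (Fin (n + 1)) K)
    (t : V K μ n) : cherednikY μ α i (p ⊗ₜ t) = α • (pderiv i (X i * p) ⊗ₜ[K] t) +
      ∑ j, divDiff₀ K i j (X i * p) ⊗ₜ[K] tabAct K μ (Equiv.swap i j) t := by
  simp only [cherednikY, LinearMap.add_apply, LinearMap.smul_apply, LinearMap.sum_apply,
    TensorProduct.map_tmul]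
  rfl

/-- The operator `∑_{j < i} s_{ij} ⊗ s_{ij}`. -/
def lowerSwaps (K : Type*) [Field K] (μ : YoungDiagram) (i : Fin (n + 1)) :
    M K μ n →ₗ[K] M K μ n :=
  ∑ j ∈ Finset.Iio i, diagAct K μ (Equiv.swap i j)

/-- Separates the part that is equivariant under all permutations (`cherednikY_diagAct`) from the
exchanges with smaller indices, which break the symmetry. -/
theorem xi_eq {α : K} (hα : α ≠ 0) (i : Fin (n + 1)) (P : M K μ n) :
    xi μ α i P = cherednikY μ α i P - α • P - lowerSwaps K μ i P := by
  have h : α • (dunkl μ α i ∘ₗ mulX K μ i) = cherednikY μ α i := by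
    apply TensorProduct.ext'
    intro p t
    rw [cherednikY_tmul, LinearMap.smul_apply, LinearMap.comp_apply, mulX_tmul, dunkl,
      LinearMap.add_apply, smul_add, LinearMap.smul_apply, smul_inv_smul₀ hα,
      LinearMap.sum_apply]
    congr 1
    rw [← Finset.add_sum_erase _ _ (Finset.mem_univ i), divDiff₀_self, LinearMap.zero_apply,
      TensorProduct.zero_tmul, zero_add]
    rw [Finset.sum_subtype (Finset.univ.erase i) (p := fun j => i ≠ j)
      (fun j => by simp [eq_comm])]
    refine Finset.sum_congr rfl fun j _ => ?_
    rw [divDiff₀_of_ne j.2]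
    rfl
  rw [← h]
  simp only [xi, cherednikU, lowerSwaps, LinearMap.sub_apply, LinearMap.smul_apply, smul_sub,
    smul_inv_smul₀ hα, LinearMap.id_apply]
  abel

/-- Only `∂_{ik}` fails to commute with `x_k`; its twisted Leibniz rule produces the exchange term.
-/
theorem cherednikY_mulX_of_ne (α : K) {i k : Fin (n + 1)} (h : i ≠ k) (P : M K μ n) :
    cherednikY μ α i (mulX K μ k P) =
      mulX K μ k (cherednikY μ α i P) - mulX K μ k (diagAct K μ (Equiv.swap i k) P) := by
  refine ext_tmul (f := cherednikY μ α i ∘ₗ mulX K μ k)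
    (g := mulX K μ k ∘ₗ cherednikY μ α i - mulX K μ k ∘ₗ diagAct K μ (Equiv.swap i k)) ?_ P
  intro p t
  simp only [LinearMap.comp_apply, LinearMap.sub_apply, cherednikY_tmul, mulX_tmul, diagAct_tmul,
    map_add, map_smul, map_sum]
  rw [add_sub_assoc]
  congr 1
  · rw [mul_left_comm, Derivation.leibniz, pderiv_X_of_ne h.symm, smul_zero, add_zero, smul_eq_mul]
  · rw [← Finset.add_sum_erase _ _ (Finset.mem_univ k),
      ← Finset.add_sum_erase _ _ (Finset.mem_univ k), add_sub_right_comm]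
    congr 1
    · rw [mul_left_comm, divDiff₀_X_right_mul h, TensorProduct.sub_tmul, polyAct_mul, polyAct_X,
        Equiv.swap_inv, Equiv.swap_apply_left]
    · refine Finset.sum_congr rfl fun j hj => ?_
      rw [mul_left_comm, divDiff₀_X_mul_of_ne h.symm (Finset.ne_of_mem_erase hj).symm]

/-- The derivative contributes `α x_k`, and each `∂_{kj}` contributes one exchange. -/
theorem cherednikY_mulX_self (α : K) (k : Fin (n + 1)) (P : M K μ n) :
    cherednikY μ α k (mulX K μ k P) = mulX K μ k (cherednikY μ α k P) + α • mulX K μ k P +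
      ∑ j ∈ Finset.univ.erase k, diagAct K μ (Equiv.swap k j) (mulX K μ k P) := by
  refine (ext_tmul (f := cherednikY μ α k ∘ₗ mulX K μ k)
    (g := mulX K μ k ∘ₗ cherednikY μ α k + α • mulX K μ k +
      ∑ j ∈ Finset.univ.erase k, diagAct K μ (Equiv.swap k j) ∘ₗ mulX K μ k) ?_ P).trans ?_
  swap
  · simp only [LinearMap.add_apply, LinearMap.sum_apply, LinearMap.smul_apply, LinearMap.comp_apply]
  intro p t
  simp only [LinearMap.comp_apply, LinearMap.add_apply, LinearMap.sum_apply, LinearMap.smul_apply,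
    cherednikY_tmul, mulX_tmul, diagAct_tmul, map_add, map_smul, map_sum]
  have e : pderiv k (X k * (X k * p)) = X k * pderiv k (X k * p) + X k * p := by
    rw [Derivation.leibniz, pderiv_X_self, smul_eq_mul, smul_eq_mul, mul_one]
  rw [e, TensorProduct.add_tmul, smul_add, ← Finset.add_sum_erase _ _ (Finset.mem_univ k),
    ← Finset.add_sum_erase (Finset.univ : Finset (Fin (n + 1)))
      (fun j => (X k * divDiff₀ K k j (X k * p)) ⊗ₜ[K] tabAct K μ (Equiv.swap k j) t)
      (Finset.mem_univ k)]
  simp only [divDiff₀_self, LinearMap.zero_apply, mul_zero, TensorProduct.zero_tmul, zero_add]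
  have e2 : ∑ j ∈ Finset.univ.erase k, divDiff₀ K k j (X k * (X k * p)) ⊗ₜ[K]
      tabAct K μ (Equiv.swap k j) t = ∑ j ∈ Finset.univ.erase k,
        ((X k * divDiff₀ K k j (X k * p)) ⊗ₜ[K] tabAct K μ (Equiv.swap k j) t +
          polyAct K (Equiv.swap k j) (X k * p) ⊗ₜ[K] tabAct K μ (Equiv.swap k j) t) := by
    refine Finset.sum_congr rfl fun j hj => ?_
    rw [divDiff₀_X_left_mul (Finset.ne_of_mem_erase hj).symm, TensorProduct.add_tmul]
  rw [e2, Finset.sum_add_distrib]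
  abel

theorem psiOp_apply (P : M K μ n) :
    psiOp K μ n P = mulX K μ (Fin.last n) (diagAct K μ (theta n) P) := rfl

/-! ### Commutation of `ξ̃_i` with the symmetric group and with `Ψ` -/

variable [CharZero K]

theorem diagAct_mul (σ π : Equiv.Perm (Fin (n + 1))) (P : M K μ n) :
    diagAct K μ (σ * π) P = diagAct K μ π (diagAct K μ σ P) := by
  refine ext_tmul (g := diagAct K μ π ∘ₗ diagAct K μ σ) ?_ P
  intro p t
  simp only [LinearMap.comp_apply, diagAct_tmul, polyAct_mul_perm, tabAct_mul]

theorem diagAct_swap_swap (σ : Equiv.Perm (Fin (n + 1))) (i j : Fin (n + 1)) (P : M K μ n) :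
    diagAct K μ (Equiv.swap i j) (diagAct K μ σ P) =
      diagAct K μ σ (diagAct K μ (Equiv.swap (σ i) (σ j)) P) := by
  rw [← diagAct_mul, ← diagAct_mul, Equiv.mul_swap_eq_swap_mul]

theorem diagAct_one (P : M K μ n) : diagAct K μ 1 P = P := by
  refine ext_tmul (g := LinearMap.id) ?_ P
  intro p t
  rw [diagAct_tmul, polyAct_one, tabAct_one, LinearMap.id_apply]

theorem diagAct_s_s (i : Fin n) (P : M K μ n) :
    diagAct K μ (s i) (diagAct K μ (s i) P) = P := by
  rw [← diagAct_mul, s_mul_s, diagAct_one]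

theorem cherednikY_diagAct (α : K) (σ : Equiv.Perm (Fin (n + 1))) (i : Fin (n + 1)) (P : M K μ n) :
    cherednikY μ α i (diagAct K μ σ P) = diagAct K μ σ (cherednikY μ α (σ i) P) := by
  refine ext_tmul (f := cherednikY μ α i ∘ₗ diagAct K μ σ)
    (g := diagAct K μ σ ∘ₗ cherednikY μ α (σ i)) ?_ P
  intro p t
  simp only [LinearMap.comp_apply, cherednikY_tmul, diagAct_tmul, map_add, map_smul, map_sum,
    X_mul_polyAct, pderiv_polyAct, divDiff₀_polyAct, tabAct_swap_swap]
  congr 1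
  exact Equiv.sum_comp σ fun j => polyAct K σ (divDiff₀ K (σ i) j (X (σ i) * p)) ⊗ₜ[K]
    tabAct K μ σ (tabAct K μ (Equiv.swap (σ i) j) t)

theorem lowerSwaps_diagAct (σ : Equiv.Perm (Fin (n + 1))) (i : Fin (n + 1)) (P : M K μ n) :
    lowerSwaps K μ i (diagAct K μ σ P) = diagAct K μ σ
      (∑ j ∈ (Finset.Iio i).map σ.toEmbedding, diagAct K μ (Equiv.swap (σ i) j) P) := by
  simp only [lowerSwaps, LinearMap.sum_apply, diagAct_swap_swap, Finset.sum_map, map_sum]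
  rfl

theorem Iio_succ_eq (i : Fin n) : Finset.Iio i.succ = insert i.castSucc (Finset.Iio i.castSucc) := by
  ext k
  simp only [Finset.mem_Iio, Finset.mem_insert, Fin.lt_def, Fin.ext_iff, Fin.val_castSucc,
    Fin.val_succ]
  omega

theorem map_s_Iio (i : Fin n) {k : Fin (n + 1)} (hk : k ≠ i.succ) :
    (Finset.Iio k).map (s i).toEmbedding = Finset.Iio k := by
  ext j
  rw [Finset.mem_map_equiv, Finset.mem_Iio, Finset.mem_Iio]
  change s i j < k ↔ j < k
  simp only [s, Equiv.swap_apply_def]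
  simp only [Fin.ext_iff, Fin.lt_def, Fin.val_castSucc, Fin.val_succ, ne_eq] at *
  split_ifs <;> simp only [Fin.val_castSucc, Fin.val_succ] <;> omega

/-- After transport by `s_i`, the exchanges of `i + 1` and of `i` differ only by `s_i` itself, and
`s_i² = 1` turns that term into `P`. -/
theorem xi_diagAct_s_castSucc {α : K} (hα : α ≠ 0) (i : Fin n) (P : M K μ n) :
    xi μ α i.castSucc (diagAct K μ (s i) P) = diagAct K μ (s i) (xi μ α i.succ P) + P := by
  have h : lowerSwaps K μ i.succ P = diagAct K μ (s i) P +
      ∑ j ∈ Finset.Iio i.castSucc, diagAct K μ (Equiv.swap i.succ j) P := by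
    rw [lowerSwaps, Iio_succ_eq, Finset.sum_insert (by simp), LinearMap.add_apply,
      Equiv.swap_comm, LinearMap.sum_apply]
    rfl
  rw [xi_eq hα, xi_eq hα, cherednikY_diagAct, lowerSwaps_diagAct, s_castSucc,
    map_s_Iio i Fin.castSucc_lt_succ.ne, h, map_sub, map_sub, map_add, diagAct_s_s, map_smul]
  abel

theorem xi_diagAct_s_succ {α : K} (hα : α ≠ 0) (i : Fin n) (P : M K μ n) :
    xi μ α i.succ (diagAct K μ (s i) P) = diagAct K μ (s i) (xi μ α i.castSucc P) - P := by
  have h := congrArg (diagAct K μ (s i)) (xi_diagAct_s_castSucc hα i (diagAct K μ (s i) P))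
  rw [diagAct_s_s, map_add, diagAct_s_s, diagAct_s_s] at h
  rw [h, add_sub_cancel_right]

theorem xi_diagAct_s_of_ne {α : K} (hα : α ≠ 0) (i : Fin n) {k : Fin (n + 1)}
    (h1 : k ≠ i.castSucc) (h2 : k ≠ i.succ) (P : M K μ n) :
    xi μ α k (diagAct K μ (s i) P) = diagAct K μ (s i) (xi μ α k P) := by
  rw [xi_eq hα, xi_eq hα, cherednikY_diagAct, lowerSwaps_diagAct, s_of_ne h1 h2, map_s_Iio i h2,
    map_sub, map_sub, map_smul, lowerSwaps, LinearMap.sum_apply]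

theorem map_theta_insert {k : Fin (n + 1)} (hk : k ≠ Fin.last n) :
    Finset.Iio (theta n k) =
      insert (theta n (Fin.last n)) ((Finset.Iio k).map (theta n).toEmbedding) := by
  have hk' : k.val < n := lt_of_le_of_ne (Nat.lt_succ_iff.1 k.2) fun h => hk (Fin.ext h)
  have hv := theta_val_of_ne hk
  ext j
  obtain ⟨i, rfl⟩ := (theta n).surjective j
  rw [Finset.mem_insert, Finset.mem_map_equiv, Equiv.symm_apply_apply, Finset.mem_Iio,
    Finset.mem_Iio, EmbeddingLike.apply_eq_iff_eq]
  by_cases hi : i = Fin.last n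
  · subst hi
    refine iff_of_true ?_ (Or.inl rfl)
    rw [theta_last, Fin.lt_def, hv]
    simp
  · rw [Fin.lt_def, hv, theta_val_of_ne hi, Fin.lt_def]
    simp [hi]

/-- `θ` carries the indices below `k` to those below `θ(k)` except the first one, `θ(N)`. The
missing exchange is the one created in passing `x_N`. -/
theorem xi_psiOp_of_ne {α : K} (hα : α ≠ 0) {k : Fin (n + 1)} (hk : k ≠ Fin.last n)
    (P : M K μ n) : xi μ α k (psiOp K μ n P) = psiOp K μ n (xi μ α (theta n k) P) := by
  have h1 : lowerSwaps K μ k (psiOp K μ n P) =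
      mulX K μ (Fin.last n) (lowerSwaps K μ k (diagAct K μ (theta n) P)) := by
    rw [lowerSwaps, LinearMap.sum_apply, LinearMap.sum_apply, map_sum]
    refine Finset.sum_congr rfl fun j hj => ?_
    have hj' : Fin.last n ≠ j := ((Finset.mem_Iio.1 hj).trans_le (Fin.le_last k)).ne'
    have := diagAct_mulX (K := K) (μ := μ) (Equiv.swap k j) (Fin.last n)
      (diagAct K μ (theta n) P)
    rw [Equiv.swap_apply_of_ne_of_ne hk.symm hj'] at this
    exact this
  have h2 : lowerSwaps K μ (theta n k) P =
      diagAct K μ (Equiv.swap (theta n k) (theta n (Fin.last n))) P +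
      ∑ j ∈ (Finset.Iio k).map (theta n).toEmbedding,
        diagAct K μ (Equiv.swap (theta n k) j) P := by
    rw [lowerSwaps, map_theta_insert hk, Finset.sum_insert, LinearMap.add_apply,
      LinearMap.sum_apply]
    rw [Finset.mem_map_equiv, Equiv.symm_apply_apply]
    simpa using Fin.le_last k
  rw [xi_eq hα, xi_eq hα, h1, psiOp_apply, psiOp_apply, cherednikY_mulX_of_ne α hk,
    cherednikY_diagAct, lowerSwaps_diagAct, h2, diagAct_swap_swap]
  simp only [map_sub, map_add, map_smul]
  abel

/-- The exchanges created by `x_N` are exactly those subtracted in `ξ̃_N`, the first index has none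
to subtract, and the derivative leaves the shift by `α`. -/
theorem xi_psiOp_last {α : K} (hα : α ≠ 0) (P : M K μ n) :
    xi μ α (Fin.last n) (psiOp K μ n P) =
      psiOp K μ n (xi μ α (theta n (Fin.last n)) P) + α • psiOp K μ n P := by
  have h1 : lowerSwaps K μ (theta n (Fin.last n)) P = 0 := by
    have : Finset.Iio (0 : Fin (n + 1)) = ∅ := by ext; simp
    rw [lowerSwaps, theta_last, this]
    rfl
  have h2 : Finset.univ.erase (Fin.last n) = Finset.Iio (Fin.last n) := by
    ext j; simp only [Finset.mem_erase, Finset.mem_univ, and_true, Finset.mem_Iio,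
      Fin.lt_last_iff_ne_last]
  rw [xi_eq hα, xi_eq hα, h1, psiOp_apply, psiOp_apply, cherednikY_mulX_self,
    cherednikY_diagAct, h2, lowerSwaps, LinearMap.sum_apply]
  simp only [map_sub, map_smul, map_zero]
  abel

end Operators

/-! ## Triangularity of the Cherednik operators -/

section Triangularity

open MvPolynomial

variable {K : Type*} [Field K] {μ : YoungDiagram} {n : ℕ}

/-- The monomial `x^v`. -/
def xPow (K : Type*) [Field K] (v : Fin (n + 1) → ℕ) : MvPolynomial (Fin (n + 1)) K :=
  ∏ k, X k ^ v k

theorem xPow_eq_monomial (v : Fin (n + 1) → ℕ) :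
    xPow K v = monomial (Finsupp.equivFunOnFinite.symm v) 1 := by
  rw [monomial_eq, C_1, one_mul, Finsupp.prod_fintype _ _ (by simp)]
  rfl

theorem polyAct_xPow (σ : Equiv.Perm (Fin (n + 1))) (v : Fin (n + 1) → ℕ) :
    polyAct K σ (xPow K v) = xPow K (v ∘ σ) := by
  have h : polyAct K σ (xPow K v) = ∏ k, X (σ⁻¹ k) ^ v k := by
    simp only [polyAct, AlgHom.toLinearMap_apply, xPow, map_prod, map_pow, rename_X]
  rw [h, xPow, ← Equiv.prod_comp σ]
  refine Finset.prod_congr rfl fun k _ => ?_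
  rw [show σ⁻¹ (σ k) = k from σ.symm_apply_apply k]
  rfl

theorem X_mul_xPow (i : Fin (n + 1)) (v : Fin (n + 1) → ℕ) :
    X i * xPow K v = xPow K (Function.update v i (v i + 1)) := by
  rw [xPow, xPow, ← Finset.mul_prod_erase _ _ (Finset.mem_univ i),
    ← Finset.mul_prod_erase _ (fun k => X k ^ Function.update v i (v i + 1) k)
      (Finset.mem_univ i), ← mul_assoc, Function.update_self, pow_succ']
  congr 1
  refine Finset.prod_congr rfl fun k hk => ?_
  rw [Function.update_of_ne (Finset.ne_of_mem_erase hk)]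

theorem pderiv_X_mul_xPow (i : Fin (n + 1)) (v : Fin (n + 1) → ℕ) :
    pderiv i (X i * xPow K v) = ((v i : K) + 1) • xPow K v := by
  have e : Finsupp.equivFunOnFinite.symm (Function.update v i (v i + 1)) - Finsupp.single i 1 =
      Finsupp.equivFunOnFinite.symm v := by
    ext k
    by_cases h : k = i
    · subst h; simp
    · simp [h]
  rw [X_mul_xPow, xPow_eq_monomial, pderiv_monomial, xPow_eq_monomial, smul_monomial, e]
  simp

theorem xPow_update₂ (v : Fin (n + 1) → ℕ) {i j : Fin (n + 1)} (h : i ≠ j) (c d : ℕ) :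
    xPow K (update₂ v i j c d) =
      X i ^ c * X j ^ d * ∏ k ∈ (Finset.univ.erase i).erase j, X k ^ v k := by
  rw [xPow, ← Finset.mul_prod_erase _ _ (Finset.mem_univ i),
    ← Finset.mul_prod_erase _ _ (Finset.mem_erase.2 ⟨h.symm, Finset.mem_univ j⟩), ← mul_assoc,
    update₂_left v h, update₂_right]
  congr 1
  refine Finset.prod_congr rfl fun k hk => ?_
  simp only [Finset.mem_erase] at hk
  rw [update₂_of_ne v hk.2.1 hk.1]

theorem X_sub_X_mul_sum_xPow (v : Fin (n + 1) → ℕ) {i j : Fin (n + 1)} (h : i ≠ j) (c m : ℕ) :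
    (X i - X j) * ∑ k ∈ Finset.range m, xPow K (update₂ v i j (c + k) (c + (m - 1 - k))) =
      xPow K (update₂ v i j (c + m) c) - xPow K (update₂ v i j c (c + m)) := by
  have e := geom_sum₂_mul (X i : MvPolynomial (Fin (n + 1)) K) (X j) m
  simp only [xPow_update₂ v h]
  rw [pow_add, pow_add]
  set R := ∏ k ∈ (Finset.univ.erase i).erase j, (X k : MvPolynomial (Fin (n + 1)) K) ^ v k
  have hs : ∑ k ∈ Finset.range m, (X i : MvPolynomial (Fin (n + 1)) K) ^ (c + k) *
      X j ^ (c + (m - 1 - k)) * R =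
      X i ^ c * X j ^ c * R * ∑ k ∈ Finset.range m, X i ^ k * X j ^ (m - 1 - k) := by
    rw [Finset.mul_sum]
    refine Finset.sum_congr rfl fun k _ => ?_
    rw [pow_add, pow_add]
    ring
  rw [hs]
  linear_combination X i ^ c * X j ^ c * R * e

theorem X_mul_sub_polyAct_swap (v : Fin (n + 1) → ℕ) {i j : Fin (n + 1)} (h : i ≠ j) :
    X i * xPow K v - polyAct K (Equiv.swap i j) (X i * xPow K v) =
      xPow K (update₂ v i j (v i + 1) (v j)) - xPow K (update₂ v i j (v j) (v i + 1)) := by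
  have e : Function.update v i (v i + 1) = update₂ v i j (v i + 1) (v j) := by
    rw [update₂, eq_comm, Function.update_eq_self_iff, Function.update_of_ne h.symm]
  rw [X_mul_xPow, polyAct_xPow, e]
  congr 2
  funext k
  by_cases hi : k = i
  · subst hi; simp [update₂_left v h, update₂_right]
  by_cases hj : k = j
  · subst hj; simp [update₂_left v h, update₂_right]
  · simp [update₂_of_ne v hi hj, Equiv.swap_apply_of_ne_of_ne hi hj]

theorem divDiff₀_X_mul_xPow_of_le (v : Fin (n + 1) → ℕ) {i j : Fin (n + 1)} (h : i ≠ j) {m : ℕ}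
    (hm : v i + 1 = v j + m) : divDiff₀ K i j (X i * xPow K v) =
      ∑ k ∈ Finset.range m, xPow K (update₂ v i j (v j + k) (v j + (m - 1 - k))) := by
  apply eq_divDiff₀ h
  rw [X_mul_sub_polyAct_swap v h, X_sub_X_mul_sum_xPow v h, hm]

theorem divDiff₀_X_mul_xPow_of_lt (v : Fin (n + 1) → ℕ) {i j : Fin (n + 1)} (h : i ≠ j) {m : ℕ}
    (hm : v j = v i + 1 + m) : divDiff₀ K i j (X i * xPow K v) =
      -∑ k ∈ Finset.range m, xPow K (update₂ v i j (v i + 1 + k) (v i + 1 + (m - 1 - k))) := by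
  apply eq_divDiff₀ h
  rw [X_mul_sub_polyAct_swap v h, mul_neg, X_sub_X_mul_sum_xPow v h, hm, neg_sub]

/-- The span of the monomials `x^w` with `w ◁ v`. -/
def lowPoly (K : Type*) [Field K] (v : Fin (n + 1) → ℕ) :
    Submodule K (MvPolynomial (Fin (n + 1)) K) :=
  Submodule.span K (xPow K '' {w | VecLT w v})

theorem xPow_mem_lowPoly {v w : Fin (n + 1) → ℕ} (h : VecLT w v) : xPow K w ∈ lowPoly K v :=
  Submodule.subset_span ⟨w, h, rfl⟩

/-- Up to sign the quotient is a geometric sum between `v ∘ s_ij` and `v`, and interior exponents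
are lower by `update₂_vecLT`. Both end points occur if `v i > v j`, neither if `v i < v j`, and they
coincide if `v i = v j`. The exchange subtracted for `j < i` is the one in `lowerSwaps`. The
condition under which `x^v` survives is `σ_v(i) < σ_v(j)`. -/
theorem divDiff₀_X_mul_xPow_mem (v : Fin (n + 1) → ℕ) {i j : Fin (n + 1)} (h : i ≠ j) :
    divDiff₀ K i j (X i * xPow K v) - (if j < i then xPow K (v ∘ Equiv.swap i j) else 0) -
      (if v j < v i ∨ (v i = v j ∧ i < j) then xPow K v else 0) ∈ lowPoly K v := by
  rcases lt_trichotomy (v i) (v j) with hv | hv | hv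
  · obtain ⟨m, hm⟩ := Nat.exists_eq_add_of_lt hv
    have hm' : v j = v i + 1 + m := by omega
    rw [divDiff₀_X_mul_xPow_of_lt v h hm', if_neg (c := v j < v i ∨ _) (by omega), sub_zero]
    refine Submodule.sub_mem _ (Submodule.neg_mem _ (Submodule.sum_mem _ fun k hk => ?_)) ?_
    · rw [Finset.mem_range] at hk
      exact xPow_mem_lowPoly (update₂_vecLT h (by omega) (by omega) (by omega))
    · split_ifs with hji
      · rw [Equiv.swap_comm]
        exact xPow_mem_lowPoly (comp_swap_vecLT hji hv)
      · exact Submodule.zero_mem _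
  · have hsw : v ∘ Equiv.swap i j = v := by
      conv_rhs => rw [← update₂_self v (i := i) (j := j)]
      rw [← update₂_swap v h, hv]
    rw [divDiff₀_X_mul_xPow_of_le v h (m := 1) (by omega), Finset.sum_range_one, hsw]
    have e : update₂ v i j (v j + 0) (v j + (1 - 1 - 0)) = v := by
      conv_rhs => rw [← update₂_self v (i := i) (j := j)]
      rw [hv]
      rfl
    rw [e]
    rcases lt_or_gt_of_ne h with hij | hij
    · simp [hij, hv, hij.not_gt]
    · simp [hij, hv, hij.not_gt]
  · obtain ⟨p, hp⟩ := Nat.exists_eq_add_of_lt hv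
    -- The `p + 2` terms are the two end points and `p` interior exponents.
    rw [divDiff₀_X_mul_xPow_of_le v h (m := p + 2) (by omega), if_pos (c := v j < v i ∨ _) (by omega),
      Finset.sum_range_succ, Finset.sum_range_succ']
    have e0 : update₂ v i j (v j + 0) (v j + (p + 2 - 1 - 0)) = v ∘ Equiv.swap i j := by
      rw [← update₂_swap v h]
      congr 1
      omega
    have e1 : update₂ v i j (v j + (p + 1)) (v j + (p + 2 - 1 - (p + 1))) = v := by
      conv_rhs => rw [← update₂_self v (i := i) (j := j)]
      congr 1 <;> omega
    rw [e0, e1]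
    have hs : ∑ k ∈ Finset.range p, xPow K (update₂ v i j (v j + (k + 1))
        (v j + (p + 2 - 1 - (k + 1)))) ∈ lowPoly K v := by
      refine Submodule.sum_mem _ fun k hk => ?_
      rw [Finset.mem_range] at hk
      exact xPow_mem_lowPoly (update₂_vecLT h (by omega) (by omega) (by omega))
    split_ifs with hji
    · convert hs using 1
      abel
    · convert Submodule.add_mem _ hs (xPow_mem_lowPoly (K := K) (comp_swap_vecLT (v := v)
        (lt_of_le_of_ne (not_lt.1 hji) h) hv)) using 1
      abel

/-- The space `M_μ` as finitely supported functions from exponents to `V_μ`. -/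
def coeffEquiv (K : Type*) [Field K] (μ : YoungDiagram) (n : ℕ) :
    M K μ n ≃ₗ[K] (Fin (n + 1) → ℕ) →₀ V K μ n :=
  (TensorProduct.equivFinsuppOfBasisLeft (basisMonomials (Fin (n + 1)) K)).trans
    (Finsupp.domLCongr Finsupp.equivFunOnFinite)

theorem coeffEquiv_xPow_tmul (v : Fin (n + 1) → ℕ) (t : V K μ n) :
    coeffEquiv K μ n (xPow K v ⊗ₜ t) = Finsupp.single v t := by
  have h : xPow K v = basisMonomials (Fin (n + 1)) K (Finsupp.equivFunOnFinite.symm v) := by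
    rw [coe_basisMonomials, xPow_eq_monomial]
  rw [h, coeffEquiv, LinearEquiv.trans_apply, TensorProduct.equivFinsuppOfBasisLeft_apply_tmul,
    Module.Basis.repr_self, Finsupp.mapRange_single, one_smul, Finsupp.domLCongr_single,
    Equiv.apply_symm_apply]

theorem eq_sum_xPow_tmul (P : M K μ n) :
    P = ∑ v ∈ (coeffEquiv K μ n P).support, xPow K v ⊗ₜ[K] coeffEquiv K μ n P v := by
  apply (coeffEquiv K μ n).injective
  simp only [map_sum, coeffEquiv_xPow_tmul]
  exact (Finsupp.sum_single _).symm

theorem ext_xPow_tmul {W : Type*} [AddCommMonoid W] [Module K W] {f g : M K μ n →ₗ[K] W}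
    (h : ∀ v t, f (xPow K v ⊗ₜ t) = g (xPow K v ⊗ₜ t)) (P : M K μ n) : f P = g P := by
  rw [eq_sum_xPow_tmul P, map_sum, map_sum]
  exact Finset.sum_congr rfl fun v _ => h v _

/-- The elements of `M_μ` whose exponents `w` all satisfy `w ◁ v`. -/
def low (K : Type*) [Field K] (μ : YoungDiagram) (v : Fin (n + 1) → ℕ) : Submodule K (M K μ n) :=
  (Finsupp.supported (V K μ n) K {w | VecLT w v}).comap (coeffEquiv K μ n).toLinearMap

theorem mem_low {v : Fin (n + 1) → ℕ} {P : M K μ n} :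
    P ∈ low K μ v ↔ ∀ w, coeffEquiv K μ n P w ≠ 0 → VecLT w v := by
  rw [low, Submodule.mem_comap, Finsupp.mem_supported]
  simp only [Set.subset_def, Finset.mem_coe, Finsupp.mem_support_iff]
  rfl

theorem xPow_tmul_mem_low {v w : Fin (n + 1) → ℕ} (h : VecLT w v) (t : V K μ n) :
    xPow K w ⊗ₜ t ∈ low K μ v := by
  rw [mem_low]
  intro u hu
  rw [coeffEquiv_xPow_tmul] at hu
  by_cases huw : u = w
  · exact huw ▸ h
  · exact absurd (Finsupp.single_eq_of_ne huw) hu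

theorem tmul_mem_low {v : Fin (n + 1) → ℕ} {p : MvPolynomial (Fin (n + 1)) K}
    (hp : p ∈ lowPoly K v) (t : V K μ n) : p ⊗ₜ t ∈ low K μ v := by
  have h : lowPoly K v ≤ (low K μ v).comap ((TensorProduct.mk K _ _).flip t) := by
    rw [lowPoly, Submodule.span_le]
    rintro _ ⟨w, hw, rfl⟩
    exact xPow_tmul_mem_low hw t
  exact h hp

/-- The diagonal part of `ξ̃_i` on `x^v ⊗ V_μ`. -/
def diagPart (μ : YoungDiagram) (α : K) (v : Fin (n + 1) → ℕ) (i : Fin (n + 1)) (t : V K μ n) :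
    V K μ n :=
  (α * v i) • t + tabAct K μ (standardization v) (jucysMurphy K μ (standardization v i)
    (tabAct K μ (standardization v)⁻¹ t))

variable [CharZero K]

theorem sum_tabAct_swap (σ : Equiv.Perm (Fin (n + 1))) (i : Fin (n + 1)) (t : V K μ n) :
    ∑ j ∈ Finset.univ.filter (fun j => σ i < σ j), tabAct K μ (Equiv.swap i j) t =
      tabAct K μ σ (jucysMurphy K μ (σ i) (tabAct K μ σ⁻¹ t)) := by
  rw [jucysMurphy, LinearMap.sum_apply, map_sum]
  refine Finset.sum_equiv σ (fun j => by simp) fun j _ => ?_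
  rw [← tabAct_swap_swap, tabAct_inv_apply]

/-- The exchanges with `j < i` cancel against `lowerSwaps`. The surviving copies of `x^v` run over
`σ_v(i) < σ_v(j)` and add up to the conjugated Jucys–Murphy element. The derivative gives `α (v i +
1)`, from which `ξ̃_i` subtracts `α`. -/
theorem xi_xPow_tmul_sub_mem {α : K} (hα : α ≠ 0) (v : Fin (n + 1) → ℕ) (i : Fin (n + 1))
    (t : V K μ n) :
    xi μ α i (xPow K v ⊗ₜ t) - xPow K v ⊗ₜ[K] diagPart μ α v i t ∈ low K μ v := by
  have h1 : ∑ j, divDiff₀ K i j (X i * xPow K v) ⊗ₜ[K] tabAct K μ (Equiv.swap i j) t =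
      ∑ j ∈ Finset.univ.erase i,
        divDiff₀ K i j (X i * xPow K v) ⊗ₜ[K] tabAct K μ (Equiv.swap i j) t := by
    rw [← Finset.add_sum_erase _ _ (Finset.mem_univ i), divDiff₀_self, LinearMap.zero_apply,
      TensorProduct.zero_tmul, zero_add]
  have h2 : lowerSwaps K μ i (xPow K v ⊗ₜ t) = ∑ j ∈ Finset.univ.erase i,
      (if j < i then xPow K (v ∘ Equiv.swap i j) else 0) ⊗ₜ[K]
        tabAct K μ (Equiv.swap i j) t := by
    have e : Finset.Iio i = (Finset.univ.erase i).filter (· < i) := by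
      ext j
      simp only [Finset.mem_Iio, Finset.mem_filter, Finset.mem_erase, Finset.mem_univ, and_true]
      exact ⟨fun h => ⟨h.ne, h⟩, fun h => h.2⟩
    rw [lowerSwaps, LinearMap.sum_apply, e, Finset.sum_filter]
    refine Finset.sum_congr rfl fun j _ => ?_
    split_ifs
    · rw [diagAct_tmul, polyAct_xPow]
    · rw [TensorProduct.zero_tmul]
  have h3 : xPow K v ⊗ₜ[K] tabAct K μ (standardization v) (jucysMurphy K μ (standardization v i)
      (tabAct K μ (standardization v)⁻¹ t)) = ∑ j ∈ Finset.univ.erase i,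
      (if v j < v i ∨ (v i = v j ∧ i < j) then xPow K v else 0) ⊗ₜ[K]
        tabAct K μ (Equiv.swap i j) t := by
    have e : Finset.univ.filter (fun j => standardization v i < standardization v j) =
        (Finset.univ.erase i).filter fun j => v j < v i ∨ (v i = v j ∧ i < j) := by
      ext j
      simp only [Finset.mem_filter, Finset.mem_erase, Finset.mem_univ, true_and, and_true,
        standardization_lt_iff]
      refine ⟨fun h => ⟨?_, h⟩, fun h => h.2⟩
      rintro rfl
      simp at h
    rw [← sum_tabAct_swap, e, Finset.sum_filter, TensorProduct.tmul_sum]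
    refine Finset.sum_congr rfl fun j _ => ?_
    split_ifs
    · rfl
    · rw [TensorProduct.tmul_zero, TensorProduct.zero_tmul]
  have h4 : xi μ α i (xPow K v ⊗ₜ t) - xPow K v ⊗ₜ[K] diagPart μ α v i t =
      ∑ j ∈ Finset.univ.erase i, (divDiff₀ K i j (X i * xPow K v) -
        (if j < i then xPow K (v ∘ Equiv.swap i j) else 0) -
        (if v j < v i ∨ (v i = v j ∧ i < j) then xPow K v else 0)) ⊗ₜ[K]
          tabAct K μ (Equiv.swap i j) t := by
    simp only [TensorProduct.sub_tmul, Finset.sum_sub_distrib]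
    rw [← h1, ← h2, ← h3, xi_eq hα, cherednikY_tmul, pderiv_X_mul_xPow, diagPart,
      TensorProduct.tmul_add, TensorProduct.tmul_smul, ← TensorProduct.smul_tmul']
    module
  rw [h4]
  exact Submodule.sum_mem _ fun j hj =>
    tmul_mem_low (divDiff₀_X_mul_xPow_mem v (Finset.ne_of_mem_erase hj).symm) _

/-! ### Rigidity of simultaneous eigenfunctions -/

theorem jucysMurphy_apply (k : Fin (n + 1)) (t : V K μ n) (τ : RST μ (n + 1)) :
    jucysMurphy K μ k t τ = (content τ k : K) * t τ := by
  induction t using Finsupp.induction_linear with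
  | zero => simp
  | add f g hf hg => rw [map_add, Finsupp.add_apply, Finsupp.add_apply, hf, hg, mul_add]
  | single τ' c =>
    rw [← Finsupp.smul_single_one, map_smul, jucysMurphy_single]
    by_cases h : τ = τ'
    · subst h; simp [mul_comm]
    · simp [Finsupp.single_eq_of_ne h]

/-- Exponents only move downwards, so no other exponent of `P` contributes at `w`. -/
theorem coeffEquiv_xi_of_maximal {α : K} (hα : α ≠ 0) (i : Fin (n + 1)) (P : M K μ n)
    {w : Fin (n + 1) → ℕ} (hw : ∀ u ∈ (coeffEquiv K μ n P).support, ¬ VecLT w u) :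
    coeffEquiv K μ n (xi μ α i P) w = diagPart μ α w i (coeffEquiv K μ n P w) := by
  classical
  have key : ∀ u ∈ (coeffEquiv K μ n P).support,
      coeffEquiv K μ n (xi μ α i (xPow K u ⊗ₜ coeffEquiv K μ n P u)) w =
        if u = w then diagPart μ α w i (coeffEquiv K μ n P w) else 0 := by
    intro u hu
    have hlow := mem_low.1 (xi_xPow_tmul_sub_mem hα u i (coeffEquiv K μ n P u)) w
    have h0 := not_imp_comm.1 hlow (hw u hu)
    rw [map_sub, Finsupp.sub_apply, sub_eq_zero, coeffEquiv_xPow_tmul] at h0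
    rw [h0, Finsupp.single_apply]
    split_ifs with h
    · rw [h]
    · rfl
  conv_lhs => rw [eq_sum_xPow_tmul P]
  rw [map_sum, map_sum, Finsupp.finsetSum_apply, Finset.sum_congr rfl key, Finset.sum_ite_eq']
  split_ifs with h
  · rfl
  · rw [Finsupp.notMem_support_iff] at h
    simp [h, diagPart]

/-- Otherwise `α = (c - a)/(b - d)` would be rational. -/
theorem eq_of_eigenvalue {α : K} (hα : Transcendental ℚ α) {a b c d : ℤ}
    (h : (a : K) + α * b = c + α * d) : b = d := by
  by_contra hne
  refine hα ?_
  have h' : ((b - d : ℤ) : K) ≠ 0 := Int.cast_ne_zero.2 (sub_ne_zero.2 hne)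
  have e : α = algebraMap ℚ K ((c - a : ℤ) / (b - d : ℤ)) := by
    rw [map_div₀, map_intCast, map_intCast, eq_div_iff h']
    push_cast
    linear_combination h
  rw [e]
  exact isAlgebraic_algebraMap _

theorem ne_zero_of_transcendental {α : K} (hα : Transcendental ℚ α) : α ≠ 0 :=
  fun h => hα (h ▸ isAlgebraic_zero)

/-- At a maximal exponent the eigenvalue equation lives in `V_μ`. Undoing the twist by `σ_w` and
reading a nonzero tableau coordinate equates `c_i + α v[i]` with a content plus `α w[i]`. -/
theorem eq_of_maximal_of_eigenfunction {α : K} (hα : Transcendental ℚ α) {v : Fin (n + 1) → ℕ}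
    {c : Fin (n + 1) → ℤ} {P : M K μ n} (h : ∀ i, xi μ α i P = ((c i : K) + α * v i) • P)
    {w : Fin (n + 1) → ℕ} (hw : w ∈ (coeffEquiv K μ n P).support)
    (hmax : ∀ u ∈ (coeffEquiv K μ n P).support, ¬ VecLT w u) : w = v := by
  funext i
  have e := coeffEquiv_xi_of_maximal (ne_zero_of_transcendental hα) i P hmax
  rw [h, map_smul, Finsupp.smul_apply, diagPart] at e
  rw [Finsupp.mem_support_iff] at hw
  set t := coeffEquiv K μ n P w
  set t' := tabAct K μ (standardization w)⁻¹ t with ht'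
  have ht : t = tabAct K μ (standardization w) t' := (tabAct_inv_apply _ _).symm
  have hne : t' ≠ 0 := by
    intro h0
    rw [h0, map_zero] at ht
    exact hw ht
  obtain ⟨τ, hτ⟩ := Finsupp.ne_iff.1 hne
  have e' := congrArg (tabAct K μ (standardization w)⁻¹) e
  rw [map_add, map_smul, map_smul, tabAct_apply_inv, ← ht'] at e'
  have e2 := DFunLike.congr_fun e' τ
  rw [Finsupp.add_apply, Finsupp.smul_apply, Finsupp.smul_apply, jucysMurphy_apply, smul_eq_mul,
    smul_eq_mul, ← add_mul] at e2
  have e3 := mul_right_cancel₀ hτ e2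
  have := eq_of_eigenvalue hα (a := c i) (b := v i) (c := content τ (standardization w i))
    (d := w i) (by push_cast; rw [e3, add_comm])
  exact_mod_cast this.symm

theorem support_of_eigenfunction {α : K} (hα : Transcendental ℚ α) {v : Fin (n + 1) → ℕ}
    {c : Fin (n + 1) → ℤ} {P : M K μ n}
    (h : ∀ i, xi μ α i P = ((c i : K) + α * v i) • P) (w : Fin (n + 1) → ℕ)
    (hw : coeffEquiv K μ n P w ≠ 0) : w = v ∨ VecLT w v :=
  eq_or_vecLT_of_maximal (fun _ hu hmax => eq_of_maximal_of_eigenfunction hα h hu hmax) w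
    (Finsupp.mem_support_iff.2 hw)

theorem eq_zero_of_eigenfunction {α : K} (hα : Transcendental ℚ α) {v : Fin (n + 1) → ℕ}
    {c : Fin (n + 1) → ℤ} {P : M K μ n} (h : ∀ i, xi μ α i P = ((c i : K) + α * v i) • P)
    (hv : coeffEquiv K μ n P v = 0) : P = 0 := by
  by_contra hP
  have hne : (coeffEquiv K μ n P).support.Nonempty := by
    rw [Finsupp.support_nonempty_iff]
    exact fun h0 => hP ((LinearEquiv.map_eq_zero_iff _).1 h0)
  obtain ⟨w, hw, hmax⟩ := exists_vecLT_maximal hne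
  rw [eq_of_maximal_of_eigenfunction hα h hw hmax] at hw
  exact Finsupp.mem_support_iff.1 hw hv

end Triangularity

/-! ## The polynomials attached to paths -/

section Paths

open MvPolynomial

variable {K : Type*} [Field K] {μ : YoungDiagram} {n : ℕ}

theorem affineVec_last {R : Type*} [Add R] (a : R) (v : Fin (n + 1) → R) :
    affineVec a v (Fin.last n) = v (theta n (Fin.last n)) + a := if_pos rfl

theorem affineVec_of_ne {R : Type*} [Add R] (a : R) (v : Fin (n + 1) → R) {k : Fin (n + 1)}
    (h : k ≠ Fin.last n) : affineVec a v k = v (theta n k) := if_neg h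

theorem affineVec_one_eq (v : Fin (n + 1) → ℕ) :
    affineVec 1 v = Function.update (v ∘ theta n) (Fin.last n) (v (theta n (Fin.last n)) + 1) := by
  funext k
  by_cases h : k = Fin.last n
  · subst h; rw [affineVec_last, Function.update_self]
  · rw [affineVec_of_ne _ _ h, Function.update_of_ne h, Function.comp_apply]

theorem affineVec_one_injective :
    Function.Injective (affineVec 1 : (Fin (n + 1) → ℕ) → Fin (n + 1) → ℕ) := by
  intro u w h
  funext k
  obtain ⟨k, rfl⟩ := (theta n).surjective k
  have := congrFun h k
  simp only [affineVec] at this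
  split_ifs at this <;> omega

theorem coeffEquiv_diagAct (σ : Equiv.Perm (Fin (n + 1))) (P : M K μ n) (v : Fin (n + 1) → ℕ) :
    coeffEquiv K μ n (diagAct K μ σ P) (v ∘ σ) = tabAct K μ σ (coeffEquiv K μ n P v) := by
  refine ext_xPow_tmul (f := Finsupp.lapply (v ∘ σ) ∘ₗ (coeffEquiv K μ n).toLinearMap ∘ₗ
    diagAct K μ σ) (g := tabAct K μ σ ∘ₗ Finsupp.lapply v ∘ₗ (coeffEquiv K μ n).toLinearMap) ?_ P
  intro u t
  simp only [LinearMap.comp_apply, Finsupp.lapply_apply, LinearEquiv.coe_coe, diagAct_tmul,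
    polyAct_xPow, coeffEquiv_xPow_tmul]
  by_cases h : u = v
  · subst h; simp
  · rw [Finsupp.single_eq_of_ne' h, Finsupp.single_eq_of_ne', map_zero]
    exact fun h' => h (σ.surjective.injective_comp_right h')

theorem coeffEquiv_psiOp (P : M K μ n) (v : Fin (n + 1) → ℕ) :
    coeffEquiv K μ n (psiOp K μ n P) (affineVec 1 v) =
      tabAct K μ (theta n) (coeffEquiv K μ n P v) := by
  refine ext_xPow_tmul (f := Finsupp.lapply (affineVec 1 v) ∘ₗ (coeffEquiv K μ n).toLinearMap ∘ₗ
    psiOp K μ n) (g := tabAct K μ (theta n) ∘ₗ Finsupp.lapply v ∘ₗ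
      (coeffEquiv K μ n).toLinearMap) ?_ P
  intro u t
  have e : X (Fin.last n) * xPow K (u ∘ theta n) = xPow K (affineVec 1 u) := by
    rw [X_mul_xPow, affineVec_one_eq, Function.comp_apply]
  simp only [LinearMap.comp_apply, Finsupp.lapply_apply, LinearEquiv.coe_coe, psiOp_apply,
    diagAct_tmul, mulX_tmul, polyAct_xPow, e, coeffEquiv_xPow_tmul]
  by_cases h : u = v
  · subst h; simp
  · rw [Finsupp.single_eq_of_ne' h, Finsupp.single_eq_of_ne', map_zero]
    exact fun h' => h (affineVec_one_injective h')

theorem xPow_tmul_mem_of_mono_mem [CharZero K] {S : Submodule K (M K μ n)}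
    {v : Fin (n + 1) → ℕ} (h : ∀ τ, mono K v τ ∈ S) (t : V K μ n) : xPow K v ⊗ₜ t ∈ S := by
  rw [← tabAct_inv_apply (standardization v) t]
  generalize tabAct K μ (standardization v)⁻¹ t = t'
  induction t' using Finsupp.induction_linear with
  | zero => simp
  | add f g hf hg => rw [map_add, TensorProduct.tmul_add]; exact S.add_mem hf hg
  | single τ c =>
    rw [← Finsupp.smul_single_one, map_smul, TensorProduct.tmul_smul]
    exact S.smul_mem c (h τ)

theorem mem_of_mem_low [CharZero K] {S : Submodule K (M K μ n)} {v : Fin (n + 1) → ℕ}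
    (h : ∀ w τ, VecLT w v → mono K w τ ∈ S) {P : M K μ n} (hP : P ∈ low K μ v) : P ∈ S := by
  rw [eq_sum_xPow_tmul P]
  refine S.sum_mem fun w hw => xPow_tmul_mem_of_mono_mem (fun τ => h w τ ?_) _
  exact mem_low.1 hP w (Finsupp.mem_support_iff.1 hw)

/-- What holds for `J_P` when the path `P` ends at `x`: the permutation of `x` is the
standardization of its vector, its spectral vector is determined by its tableau and its vector,
`J_P` is an eigenfunction and the coefficient of `x^{v,τ}` is `1`. -/
structure IsJackAt (α : K) (x : Vertex K μ n) (P : M K μ n) : Prop where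
  perm_eq : x.σ = standardization x.v
  spectral : ∀ k, x.ζ k = (content x.τ (x.σ k) : K) + α * x.v k
  eigen : ∀ i, xi μ α i P = x.ζ i • P
  coeff_eq : coeffEquiv K μ n P x.v = tabAct K μ x.σ (Finsupp.single x.τ 1)

theorem IsJackAt.eigen' {α : K} {x : Vertex K μ n} {P : M K μ n} (h : IsJackAt α x P)
    (i : Fin (n + 1)) : xi μ α i P = ((content x.τ (x.σ i) : K) + α * x.v i) • P := by
  rw [h.eigen, h.spectral]

theorem IsJackAt.coeff_eq' {α : K} {x : Vertex K μ n} {P : M K μ n} (h : IsJackAt α x P) :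
    coeffEquiv K μ n P x.v = tabAct K μ (standardization x.v) (Finsupp.single x.τ 1) := by
  rw [h.coeff_eq, h.perm_eq]

theorem comp_s_eq {v : Fin (n + 1) → ℕ} {i : Fin n} (h : v i.castSucc = v i.succ) :
    v ∘ s i = v := by
  funext k
  by_cases h1 : k = i.castSucc
  · subst h1; rw [Function.comp_apply, s_castSucc, h]
  by_cases h2 : k = i.succ
  · subst h2; rw [Function.comp_apply, s_succ, h]
  · rw [Function.comp_apply, s_of_ne h1 h2]

theorem actS_of_eq {K : Type*} {x : Vertex K μ n} {i : Fin n} (hv : x.v i.castSucc = x.v i.succ)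
    (h : IsReverseStandard (swapEntries x.τ (x.σ i.castSucc) (x.σ i.succ))) :
    x.actS i = ⟨swapTab x.τ (x.σ i.castSucc) (x.σ i.succ) h, x.ζ ∘ s i, x.v, x.σ⟩ := by
  rw [Vertex.actS, if_neg (not_not.2 hv.symm), dif_pos h]
  rfl

theorem swapEntries_apply {τ : RST μ (n + 1)} (k l m : Fin (n + 1)) :
    swapEntries τ k l m = τ.1 (Equiv.swap k l m) := rfl

theorem swapEntries_ne {τ : RST μ (n + 1)} {k l : Fin (n + 1)} (hkl : k ≠ l) :
    τ.1 ≠ swapEntries τ k l := by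
  intro h
  have := DFunLike.congr_fun h k
  rw [swapEntries_apply, Equiv.swap_apply_left] at this
  exact hkl (τ.1.injective this)

theorem not_isReverseStandard_of_actS_eq {K : Type*} {x : Vertex K μ n} {i : Fin n} (h : x.actS i = x) :
    x.v i.castSucc = x.v i.succ ∧
      ¬ IsReverseStandard (swapEntries x.τ (x.σ i.castSucc) (x.σ i.succ)) := by
  have hv : x.v i.castSucc = x.v i.succ := by
    by_contra hv
    have h' := congrArg Vertex.v h
    rw [Vertex.actS, if_pos (Ne.symm hv)] at h'
    have := congrFun h' i.castSucc
    simp only [Function.comp_apply, s_castSucc] at this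
    exact hv this.symm
  refine ⟨hv, fun hs => ?_⟩
  have h' := congrArg (fun y => y.τ.1) h
  rw [actS_of_eq hv hs] at h'
  refine swapEntries_ne ?_ h'.symm
  exact fun h0 => Fin.castSucc_lt_succ.ne (x.σ.injective h0)

/-! ### Propagation of `IsJackAt` along the arrows -/

variable [CharZero K]

theorem IsJackAt.support {α : K} (hα : Transcendental ℚ α) {x : Vertex K μ n} {P : M K μ n}
    (h : IsJackAt α x P) {w : Fin (n + 1) → ℕ} (hw : coeffEquiv K μ n P w ≠ 0) :
    w = x.v ∨ VecLT w x.v :=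
  support_of_eigenfunction hα h.eigen' w hw

theorem IsJackAt.sub_mono_mem_low {α : K} (hα : Transcendental ℚ α) {x : Vertex K μ n} {P : M K μ n}
    (h : IsJackAt α x P) : P - mono K x.v x.τ ∈ low K μ x.v := by
  have hm : mono K x.v x.τ = xPow K x.v ⊗ₜ[K] tabAct K μ (standardization x.v)
    (Finsupp.single x.τ 1) := rfl
  rw [mem_low]
  intro w hw
  rw [map_sub, Finsupp.sub_apply, hm, coeffEquiv_xPow_tmul] at hw
  by_cases hwv : w = x.v
  · subst hwv
    rw [Finsupp.single_eq_same, h.coeff_eq', sub_self] at hw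
    exact absurd rfl hw
  · rw [Finsupp.single_eq_of_ne hwv, sub_zero] at hw
    exact (h.support hα hw).resolve_left hwv

theorem IsJackAt.isLeadingMonomial {α : K} (hα : Transcendental ℚ α) {x : Vertex K μ n}
    {P : M K μ n} (h : IsJackAt α x P) : IsLeadingMonomial x.v x.τ P := by
  refine ⟨1, one_ne_zero, ?_⟩
  rw [one_smul]
  refine mem_of_mem_low (fun w τ hw => ?_) (h.sub_mono_mem_low hα)
  exact Submodule.subset_span ⟨w, τ, hw, rfl⟩

theorem IsJackAt.ne_zero {α : K} {x : Vertex K μ n} {P : M K μ n} (h : IsJackAt α x P) :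
    P ≠ 0 := by
  rintro rfl
  have e := congrArg (tabAct K μ x.σ⁻¹) h.coeff_eq
  rw [tabAct_apply_inv, map_zero, Finsupp.zero_apply, map_zero] at e
  exact one_ne_zero (Finsupp.single_eq_zero.1 e.symm)

/-- The difference is an eigenfunction for the same `v` whose coefficient at `x^v` vanishes. -/
theorem IsJackAt.unique {α : K} (hα : Transcendental ℚ α) {x y : Vertex K μ n} {P Q : M K μ n}
    (hP : IsJackAt α x P) (hQ : IsJackAt α y Q) (hv : x.v = y.v) (hτ : x.τ = y.τ) : P = Q := by
  have hσ : x.σ = y.σ := by rw [hP.perm_eq, hQ.perm_eq, hv]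
  refine sub_eq_zero.1 (eq_zero_of_eigenfunction hα (v := x.v) (c := fun i => content x.τ (x.σ i))
    (fun i => ?_) ?_)
  · rw [map_sub, hP.eigen' i, hQ.eigen' i, hv, hτ, hσ, smul_sub]
  · rw [map_sub, Finsupp.sub_apply, hP.coeff_eq, hv, hQ.coeff_eq, hτ, hσ, sub_self]

/-- The Yang–Baxter operator attached to an arrow labelled `s_i`. -/
def intertwine (ζ : Fin (n + 1) → K) (i : Fin n) (P : M K μ n) : M K μ n :=
  diagAct K μ (s i) P + (1 / (ζ i.succ - ζ i.castSucc)) • P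

/-- The scalar `1 / (ζ[i+1] - ζ[i])` is chosen to absorb the terms `±P` in the relations between
`ξ̃` and `s_i`. -/
theorem xi_intertwine {α : K} (hα : α ≠ 0) {ζ : Fin (n + 1) → K} {P : M K μ n}
    (h : ∀ i, xi μ α i P = ζ i • P) {i : Fin n} (hne : ζ i.succ ≠ ζ i.castSucc)
    (k : Fin (n + 1)) : xi μ α k (intertwine ζ i P) = (ζ ∘ s i) k • intertwine ζ i P := by
  have hd : (1 / (ζ i.succ - ζ i.castSucc)) * (ζ i.succ - ζ i.castSucc) = 1 :=
    one_div_mul_cancel (sub_ne_zero.2 hne)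
  generalize hb : 1 / (ζ i.succ - ζ i.castSucc) = b at hd
  simp only [intertwine, hb, map_add, map_smul, h, Function.comp_apply]
  by_cases h1 : k = i.castSucc
  · subst h1
    rw [xi_diagAct_s_castSucc hα, h, s_castSucc, map_smul]
    linear_combination (norm := module) -(hd • P)
  by_cases h2 : k = i.succ
  · subst h2
    rw [xi_diagAct_s_succ hα, h, s_succ, map_smul]
    linear_combination (norm := module) (hd • P)
  · rw [xi_diagAct_s_of_ne hα i h1 h2, h, s_of_ne h1 h2, map_smul]
    module

/-- For a vector with equal entries at `i` and `i + 1`, the position of `i` in the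
standardization, as the index of an elementary transposition. -/
def stdIndex (v : Fin (n + 1) → ℕ) (i : Fin n) (h : v i.castSucc = v i.succ) : Fin n :=
  ⟨(standardization v i.castSucc).val, by
    have h1 := standardization_succ h
    have h2 := (standardization v i.succ).is_lt
    omega⟩

theorem stdIndex_castSucc {v : Fin (n + 1) → ℕ} {i : Fin n} (h : v i.castSucc = v i.succ) :
    (stdIndex v i h).castSucc = standardization v i.castSucc := rfl

theorem stdIndex_succ {v : Fin (n + 1) → ℕ} {i : Fin n} (h : v i.castSucc = v i.succ) :
    (stdIndex v i h).succ = standardization v i.succ :=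
  Fin.ext (standardization_succ h).symm

/-- Keeps the Yang–Baxter denominators nonzero. For `v[i] ≠ v[i+1]` this is transcendence; for equal
entries the eigenvalues differ by the contents of two consecutive entries of `τ`. -/
theorem IsJackAt.spectral_ne {α : K} (hα : Transcendental ℚ α) {x : Vertex K μ n} {P : M K μ n}
    (h : IsJackAt α x P) (i : Fin n) : x.ζ i.succ ≠ x.ζ i.castSucc := by
  rw [h.spectral, h.spectral, h.perm_eq]
  intro he
  have hv : x.v i.castSucc = x.v i.succ := by
    have := eq_of_eigenvalue hα (a := content x.τ (standardization x.v i.succ)) (b := x.v i.succ)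
      (c := content x.τ (standardization x.v i.castSucc)) (d := x.v i.castSucc)
      (by push_cast; exact he)
    exact_mod_cast this.symm
  rw [hv, add_left_inj, ← stdIndex_succ hv, ← stdIndex_castSucc hv] at he
  exact content_ne_succ x.τ (stdIndex x.v i hv) (Int.cast_injective he).symm

/-- Since `v s_i = v` and `σ_v s_i = s_k σ_v` with `k` the index `stdIndex`, the coefficient is
governed by `τ s_k`; the Yang–Baxter scalar is minus its diagonal coefficient. -/
theorem IsJackAt.coeff_intertwine {α : K} {x : Vertex K μ n} {P : M K μ n}
    (h : IsJackAt α x P) {i : Fin n} (hv : x.v i.castSucc = x.v i.succ) :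
    coeffEquiv K μ n (intertwine x.ζ i P) x.v =
      murphyOffDiag K (content x.τ (x.σ i.castSucc) - content x.τ (x.σ i.succ)) •
        tabAct K μ x.σ (swapVec K x.τ (x.σ i.castSucc) (x.σ i.succ)) := by
  have e : coeffEquiv K μ n (diagAct K μ (s i) P) x.v =
      tabAct K μ (s i) (coeffEquiv K μ n P x.v) := by
    rw [← coeffEquiv_diagAct, comp_s_eq hv]
  have e2 : Equiv.swap (x.σ i.castSucc) (x.σ i.succ) = s (stdIndex x.v i hv) := by
    rw [s, stdIndex_succ, stdIndex_castSucc, h.perm_eq]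
  have e3 : (1 : K) / (x.ζ i.succ - x.ζ i.castSucc) =
      -((content x.τ (x.σ i.castSucc) - content x.τ (x.σ i.succ) : ℤ) : K)⁻¹ := by
    rw [h.spectral, h.spectral, hv, one_div, ← inv_neg]
    push_cast
    congr 1
    ring
  rw [intertwine, map_add, map_smul, Finsupp.add_apply, Finsupp.smul_apply, e, h.coeff_eq, s,
    tabAct_swap_swap, e2, tabAct_s, murphy_single, murphyVec_eq, stdIndex_succ, stdIndex_castSucc,
    ← h.perm_eq, e3, map_add, map_smul, map_smul]
  module

theorem IsJackAt.step {α : K} (hα : Transcendental ℚ α) {x : Vertex K μ n} {P : M K μ n}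
    (h : IsJackAt α x P) {i : Fin n} (hv : x.v i.castSucc < x.v i.succ) :
    IsJackAt α (x.actS i) (intertwine x.ζ i P) := by
  have hact : x.actS i = ⟨x.τ, x.ζ ∘ s i, x.v ∘ s i, x.σ * s i⟩ := if_pos hv.ne'
  rw [hact]
  refine ⟨?_, fun k => h.spectral (s i k),
    xi_intertwine (ne_zero_of_transcendental hα) h.eigen (h.spectral_ne hα i), ?_⟩
  · exact (congrArg (· * s i) h.perm_eq).trans (standardization_comp_s hv.ne).symm
  · change coeffEquiv K μ n (diagAct K μ (s i) P + _) (x.v ∘ s i) = _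
    -- The new exponent is above `v`, hence absent from `P`, and the scalar term does not affect its
    -- coefficient.
    have hlt : VecLT x.v (x.v ∘ s i) := by
      have := comp_swap_vecLT (v := x.v ∘ s i) (i := i.castSucc) (j := i.succ)
        Fin.castSucc_lt_succ (by simpa [s_castSucc, s_succ] using hv)
      have e : (x.v ∘ s i) ∘ Equiv.swap i.castSucc i.succ = x.v :=
        funext fun k => congrArg x.v (s_involutive i k)
      rwa [e] at this
    have h0 : coeffEquiv K μ n P (x.v ∘ s i) = 0 := by
      by_contra hne
      rcases h.support hα hne with h' | h'
      · rw [h'] at hlt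
        exact VecLT.irrefl _ hlt
      · exact VecLT.irrefl x.v (hlt.trans h')
    rw [map_add, map_smul, Finsupp.add_apply, Finsupp.smul_apply, h0, smul_zero, add_zero,
      coeffEquiv_diagAct, h.coeff_eq, tabAct_mul]

theorem IsJackAt.psi {α : K} (hα : Transcendental ℚ α) {x : Vertex K μ n} {P : M K μ n}
    (h : IsJackAt α x P) : IsJackAt α (x.actPsi α) (psiOp K μ n P) := by
  have hα0 := ne_zero_of_transcendental hα
  refine ⟨?_, fun k => ?_, fun k => ?_, ?_⟩
  · exact (congrArg (· * theta n) h.perm_eq).trans (standardization_affineVec x.v).symm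
  · change affineVec α x.ζ k = (content x.τ (x.σ (theta n k)) : K) + α * (affineVec 1 x.v k : ℕ)
    by_cases hk : k = Fin.last n
    · subst hk
      rw [affineVec_last, affineVec_last, h.spectral]
      push_cast
      ring
    · rw [affineVec_of_ne _ _ hk, affineVec_of_ne _ _ hk, h.spectral]
  · change _ = affineVec α x.ζ k • _
    by_cases hk : k = Fin.last n
    · subst hk
      rw [xi_psiOp_last hα0, h.eigen, map_smul, affineVec_last, add_smul]
    · rw [xi_psiOp_of_ne hα0 hk, h.eigen, map_smul, affineVec_of_ne _ _ hk]
  · change coeffEquiv K μ n (psiOp K μ n P) (affineVec 1 x.v) = tabAct K μ (x.σ * theta n) _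
    rw [coeffEquiv_psiOp, h.coeff_eq, tabAct_mul]
    rfl

/-- As `v s_i = v`, the image is again an eigenfunction for `v`, and its coefficient at `x^v` is a
multiple of a tableau that is not standard. -/
theorem IsJackAt.fall {α : K} (hα : Transcendental ℚ α) {x : Vertex K μ n} {P : M K μ n}
    (h : IsJackAt α x P) {i : Fin n} (hx : x.actS i = x) : intertwine x.ζ i P = 0 := by
  obtain ⟨hv, hs⟩ := not_isReverseStandard_of_actS_eq hx
  refine eq_zero_of_eigenfunction hα (v := x.v) (c := fun k => content x.τ (x.σ (s i k)))
    (fun k => ?_) ?_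
  · rw [xi_intertwine (ne_zero_of_transcendental hα) h.eigen (h.spectral_ne hα i),
      Function.comp_apply, h.spectral]
    congr 4
    exact congrFun (comp_s_eq hv) k
  · rw [h.coeff_intertwine hv, swapVec, dif_neg hs, map_zero, smul_zero]

theorem IsJackAt.jump {α : K} (hα : Transcendental ℚ α) {x : Vertex K μ n} {P : M K μ n}
    (h : IsJackAt α x P) {i : Fin n} (hv : x.v i.castSucc = x.v i.succ)
    (hτ : ∃ k l : Fin (n + 1), k < l ∧ x.τ.1 = swapEntries (x.actS i).τ k l ∧
        content x.τ l + 2 ≤ content x.τ k) :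
    IsJackAt α (x.actS i) (intertwine x.ζ i P) := by
  obtain ⟨k, l, hkl, he, hc⟩ := hτ
  by_cases hs : IsReverseStandard (swapEntries x.τ (x.σ i.castSucc) (x.σ i.succ))
  swap
  -- In this case `s_i` fixes the vertex and `τ` would equal its own exchange.
  · have : x.actS i = x := by rw [Vertex.actS, if_neg (not_not.2 hv.symm), dif_neg hs]
    rw [this] at he
    exact absurd he (swapEntries_ne hkl.ne)
  rw [actS_of_eq hv hs] at he ⊢
  have hlt : x.σ i.castSucc < x.σ i.succ := by
    rw [h.perm_eq, standardization_lt_iff]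
    exact Or.inr ⟨hv, Fin.castSucc_lt_succ⟩
  -- The two exchanges cancel, so they involve the same pair; `k < l` and `hlt` fix which entry is
  -- which.
  have hsw : ∀ m, Equiv.swap (x.σ i.castSucc) (x.σ i.succ) (Equiv.swap k l m) = m := fun m =>
    (x.τ.1.injective (DFunLike.congr_fun he m)).symm
  have hk : k = x.σ i.castSucc ∧ l = x.σ i.succ := by
    have h1 := hsw k
    have h2 := hsw l
    rw [Equiv.swap_apply_left] at h1
    rw [Equiv.swap_apply_right] at h2
    rw [Equiv.swap_apply_def] at h1 h2
    split_ifs at h1 h2 with a b c d e f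
    all_goals omega
  obtain ⟨rfl, rfl⟩ := hk
  refine ⟨h.perm_eq, fun k => ?_,
    xi_intertwine (ne_zero_of_transcendental hα) h.eigen (h.spectral_ne hα i), ?_⟩
  · change x.ζ (s i k) = (fillingContent x.τ.1 (Equiv.swap (x.σ i.castSucc) (x.σ i.succ) (x.σ k)) : K)
      + α * x.v k
    have e := DFunLike.congr_fun (Equiv.mul_swap_eq_swap_mul x.σ i.castSucc i.succ) k
    rw [Equiv.Perm.mul_apply, Equiv.Perm.mul_apply] at e
    rw [← e, h.spectral]
    congr 3
    exact congrFun (comp_s_eq hv) k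
  · change coeffEquiv K μ n (intertwine x.ζ i P) x.v = tabAct K μ x.σ _
    -- The jump condition says that the contents differ by at least `2` in the direction where
    -- Murphy's off-diagonal coefficient is `1`.
    rw [h.coeff_intertwine hv, murphyOffDiag, if_pos (by omega), one_smul, swapVec_eq_single K hs]

/-- Nothing lies below the zero vector, so triangularity is an equality and the eigenvalues are the
contents. -/
theorem isJackAt_root {α : K} (hα : Transcendental ℚ α) (hμ : μ.cells.card = n + 1) :
    IsJackAt α (root K μ hμ) (1 ⊗ₜ[K] Finsupp.single (rootTab μ hμ) 1) := by
  have h1 : (1 : MvPolynomial (Fin (n + 1)) K) = xPow K (fun _ => 0) := by simp [xPow]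
  refine ⟨standardization_zero.symm, fun k => ?_, fun i => ?_, ?_⟩
  · simp [root]
  · rw [h1]
    have hlow : ∀ P ∈ low K μ (fun _ : Fin (n + 1) => 0), P = 0 := by
      intro P hP
      apply (coeffEquiv K μ n).injective
      rw [map_zero]
      ext1 w
      by_contra hw
      rcases mem_low.1 hP w hw with h | h
      · refine h.2 (h.1.antisymm fun i => ?_)
        rw [decr]
        simp
      · exact h.2.2 (h.2.1.antisymm fun i => by simp)
    have h := hlow _ (xi_xPow_tmul_sub_mem (ne_zero_of_transcendental hα) (fun _ => 0) i
      (Finsupp.single (rootTab μ hμ) (1 : K)))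
    rw [sub_eq_zero.1 h, diagPart, standardization_zero, inv_one, tabAct_one, tabAct_one,
      jucysMurphy_single]
    simp only [Nat.cast_zero, mul_zero, zero_smul, zero_add, TensorProduct.tmul_smul]
    rfl
  · rw [h1]
    change coeffEquiv K μ n _ (fun _ => 0) = tabAct K μ 1 _
    rw [coeffEquiv_xPow_tmul, Finsupp.single_eq_same, tabAct_one]
    rfl

theorem isJackAt_J {α : K} (hα : Transcendental ℚ α) {hμ : μ.cells.card = n + 1}
    {y : Option (Vertex K μ n)} (P : Path α hμ y) :
    (∀ x, y = some x → IsJackAt α x (J P)) ∧ (y = none → J P = 0) := by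
  induction P with
  | nil =>
    refine ⟨?_, by simp⟩
    rintro x hx
    cases hx
    exact isJackAt_root hα hμ
  | snoc P a h ih =>
    have ih := ih.1 _ rfl
    cases h with
    | step i hv =>
      refine ⟨?_, by simp⟩
      rintro y hy
      cases hy
      exact ih.step hα hv
    | jump i hv hτ =>
      refine ⟨?_, by simp⟩
      rintro y hy
      cases hy
      exact ih.jump hα hv hτ
    | affine =>
      refine ⟨?_, by simp⟩
      rintro y hy
      cases hy
      exact ih.psi hα
    | fall i hx => exact ⟨by simp, fun _ => ih.fall hα hx⟩

end Paths

/-! ## Every pair occurs, and the resulting basis -/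

section Basis

variable {K : Type*} [Field K] {μ : YoungDiagram} {n : ℕ}

/-- The sum of `k` times the column of the entry `k`. -/
def colWeight (τ : RST μ (n + 1)) : ℕ := ∑ k, k.val * (τ.1 k).1.2

theorem colWeight_swapTab_lt (τ : RST μ (n + 1)) (i : Fin n)
    (h : (τ.1 i.castSucc).1.2 < (τ.1 i.succ).1.2)
    (hs : IsReverseStandard (swapEntries τ i.castSucc i.succ)) :
    colWeight (swapTab τ i.castSucc i.succ hs) < colWeight τ := by
  have hne : i.castSucc ≠ i.succ := Fin.castSucc_lt_succ.ne
  rw [colWeight, colWeight, sum_eq_add_add _ (Finset.mem_univ _) (Finset.mem_univ _) hne,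
    sum_eq_add_add (fun k => k.val * (τ.1 k).1.2) (Finset.mem_univ _) (Finset.mem_univ _) hne]
  have hr : ∑ k ∈ (Finset.univ.erase i.castSucc).erase i.succ,
      k.val * ((swapTab τ i.castSucc i.succ hs).1 k).1.2 =
      ∑ k ∈ (Finset.univ.erase i.castSucc).erase i.succ, k.val * (τ.1 k).1.2 := by
    refine Finset.sum_congr rfl fun k hk => ?_
    simp only [Finset.mem_erase] at hk
    change k.val * (τ.1 (s i k)).1.2 = _
    rw [s_of_ne hk.2.1 hk.1]
  rw [hr]
  change i.castSucc.val * (τ.1 (s i i.castSucc)).1.2 + i.succ.val * (τ.1 (s i i.succ)).1.2 + _ < _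
  rw [s_castSucc, s_succ, Fin.val_castSucc, Fin.val_succ]
  linarith

/-- Within a column larger entries are higher, so under `h` decreasing entries list the cells in
increasing order of `colKey`, and this enumeration is unique. -/
theorem eq_rootTab {τ : RST μ (n + 1)} (hμ : μ.cells.card = n + 1)
    (h : ∀ i : Fin n, (τ.1 i.succ).1.2 ≤ (τ.1 i.castSucc).1.2) : τ = rootTab μ hμ := by
  have hanti : StrictAnti fun k => colKey (τ.1 k).1 := by
    rw [Fin.strictAnti_iff_succ_lt]
    intro i
    change toLex _ < toLex _
    rw [Prod.Lex.toLex_lt_toLex]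
    rcases (h i).lt_or_eq with h' | h'
    · exact Or.inl h'
    · refine Or.inr ⟨h', ?_⟩
      by_contra hr
      exact absurd (τ.lt_of_le_of_le (not_lt.1 hr) h'.ge Fin.castSucc_lt_succ.ne)
        Fin.castSucc_lt_succ.not_gt
  have hcard : (μ.cells.map colKey).card = n + 1 := by rw [Finset.card_map, hμ]
  have key := Finset.orderEmbOfFin_unique hcard (f := fun k => colKey (τ.1 k.rev).1)
    (fun k => Finset.mem_map_of_mem _ (τ.1 k.rev).2)
    (fun a b hab => hanti (Fin.rev_lt_rev.2 hab))
  apply Subtype.ext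
  apply Equiv.ext
  intro k
  have hk := congrFun key k.rev
  simp only [Fin.rev_rev] at hk
  apply (colEquiv μ).symm.injective
  apply Subtype.ext
  change colKey (τ.1 k).1 = _
  rw [hk]
  change _ = ((colEquiv μ).symm (rootPos μ hμ k)).1
  simp [rootPos]

/-- Some path ends at a vertex with vector `v` and tableau `τ`. -/
def Reachable (α : K) (hμ : μ.cells.card = n + 1) (v : Fin (n + 1) → ℕ) (τ : RST μ (n + 1)) :
    Prop :=
  ∃ (x : Vertex K μ n) (_ : Path α hμ (some x)), x.v = v ∧ x.τ = τ

theorem reachable_affineVec {α : K} {hμ : μ.cells.card = n + 1} {v : Fin (n + 1) → ℕ}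
    {τ : RST μ (n + 1)} (h : Reachable α hμ v τ) : Reachable α hμ (affineVec 1 v) τ := by
  obtain ⟨x, P, rfl, rfl⟩ := h
  exact ⟨x.actPsi α, P.snoc .psi (.affine x), rfl, rfl⟩

theorem reachable_comp_s {α : K} {hμ : μ.cells.card = n + 1} {v : Fin (n + 1) → ℕ}
    {τ : RST μ (n + 1)} (h : Reachable α hμ v τ) {i : Fin n} (hi : v i.castSucc < v i.succ) :
    Reachable α hμ (v ∘ s i) τ := by
  obtain ⟨x, P, rfl, rfl⟩ := h
  refine ⟨x.actS i, P.snoc (.s i) (.step x i hi), ?_, ?_⟩ <;> rw [Vertex.actS, if_pos hi.ne']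

variable [CharZero K]

/-- If `τ` is not the root tableau, some `i` lies in a column strictly left of `i + 1`. Exchanging
them lowers `colWeight` and puts `i` strictly north-east of `i + 1`, so the exchange back to `τ` is
a jump. -/
theorem reachable_zero {α : K} (hα : Transcendental ℚ α) (hμ : μ.cells.card = n + 1)
    (τ : RST μ (n + 1)) : Reachable α hμ (fun _ => 0) τ := by
  induction hm : colWeight τ using Nat.strong_induction_on generalizing τ with
  | _ m ih =>
  subst hm
  by_cases h : ∃ i : Fin n, (τ.1 i.castSucc).1.2 < (τ.1 i.succ).1.2
  swap
  · push Not at h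
    exact ⟨root K μ hμ, .nil, rfl, (eq_rootTab hμ h).symm⟩
  obtain ⟨i, hi⟩ := h
  have hrow : (τ.1 i.succ).1.1 < (τ.1 i.castSucc).1.1 := by
    by_contra hr
    exact absurd (τ.lt_of_le_of_le (not_lt.1 hr) hi.le Fin.castSucc_lt_succ.ne)
      Fin.castSucc_lt_succ.not_gt
  have hs := swapEntries_isReverseStandard τ i hrow.ne' hi.ne
  obtain ⟨x, P, hv, hτ⟩ := ih _ (colWeight_swapTab_lt τ i hi hs) (swapTab τ i.castSucc i.succ hs) rfl
  have hσ : x.σ = 1 := by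
    rw [((isJackAt_J hα P).1 x rfl).perm_eq, hv, standardization_zero]
  have hvi : x.v i.castSucc = x.v i.succ := by rw [hv]
  have hpos : ∀ k, x.τ.1 k = τ.1 (s i k) := fun k => by rw [hτ]; rfl
  have hsw : swapEntries x.τ i.castSucc i.succ = τ.1 := by
    apply Equiv.ext
    intro k
    rw [swapEntries_apply, hpos]
    exact congrArg τ.1 (s_involutive i k)
  have hs' : IsReverseStandard (swapEntries x.τ (x.σ i.castSucc) (x.σ i.succ)) := by
    rw [hσ]
    exact hsw ▸ τ.2
  have hact := actS_of_eq hvi hs'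
  have hτ' : (x.actS i).τ = τ := by
    rw [hact]
    apply Subtype.ext
    change swapEntries x.τ (x.σ i.castSucc) (x.σ i.succ) = τ.1
    rw [hσ]
    exact hsw
  refine ⟨x.actS i, P.snoc (.s i) (.jump x i hvi ⟨i.castSucc, i.succ, Fin.castSucc_lt_succ, ?_, ?_⟩),
    ?_, hτ'⟩
  · rw [hτ']
    exact Equiv.ext hpos
  · rw [content, content, hpos, hpos, s_castSucc, s_succ]
    omega
  · rw [hact]
    exact hv

theorem exists_affineVec_eq {v : Fin (n + 1) → ℕ} (h : 0 < v (Fin.last n)) :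
    ∃ u, affineVec 1 u = v ∧ ∑ k, v k = ∑ k, u k + 1 := by
  refine ⟨fun k => Function.update v (Fin.last n) (v (Fin.last n) - 1) ((theta n)⁻¹ k), ?_, ?_⟩
  · funext k
    have e : (theta n)⁻¹ (theta n k) = k := (theta n).symm_apply_apply k
    by_cases hk : k = Fin.last n
    · subst hk
      rw [affineVec_last, e, Function.update_self]
      omega
    · rw [affineVec_of_ne _ _ hk, e, Function.update_of_ne hk]
  · rw [Equiv.sum_comp (theta n)⁻¹ (Function.update v (Fin.last n) (v (Fin.last n) - 1)),
      Finset.sum_update_of_mem (Finset.mem_univ _),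
      ← Finset.add_sum_erase _ _ (Finset.mem_univ (Fin.last n)), Finset.sdiff_singleton_eq_erase]
    omega

/-- Induction on the degree, then on `◁`: a positive last entry allows `Ψ` to be undone, and a
descent of `v` allows a step to be undone. With neither, `v` is nondecreasing and ends in `0`, hence
is zero. -/
theorem reachable {α : K} (hα : Transcendental ℚ α) (hμ : μ.cells.card = n + 1)
    (v : Fin (n + 1) → ℕ) (τ : RST μ (n + 1)) : Reachable α hμ v τ := by
  induction hm : ∑ k, v k using Nat.strong_induction_on generalizing v with
  | _ m ih =>
  induction v using VecLT.wellFounded.induction with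
  | _ v ih' =>
  subst hm
  rcases Nat.eq_zero_or_pos (v (Fin.last n)) with h0 | h0
  · by_cases h : ∃ i : Fin n, v i.succ < v i.castSucc
    · obtain ⟨i, hi⟩ := h
      have hr := ih' (v ∘ s i) (comp_swap_vecLT Fin.castSucc_lt_succ hi) (Equiv.sum_comp (s i) v)
      have := reachable_comp_s hr (i := i) (by simpa [s_castSucc, s_succ] using hi)
      have e : (v ∘ s i) ∘ s i = v := funext fun k => congrArg v (s_involutive i k)
      rwa [e] at this
    · push Not at h
      have hmono : Monotone v := Fin.monotone_iff_le_succ.2 h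
      have : v = fun _ => 0 :=
        funext fun k => Nat.le_zero.1 (h0 ▸ hmono (Fin.le_last k))
      rw [this]
      exact reachable_zero hα hμ τ
  · obtain ⟨u, rfl, hu⟩ := exists_affineVec_eq h0
    exact reachable_affineVec (ih _ (by omega) u rfl)

/-- In a linear relation, the coefficient at a `◁`-maximal exponent `v`, untwisted by `σ_v`,
displays the scalars of the pairs `(v, τ)` on distinct tableaux. -/
theorem linearIndependent_of_isJackAt {α : K} (hα : Transcendental ℚ α)
    {F : (Fin (n + 1) → ℕ) × RST μ (n + 1) → M K μ n}
    (hF : ∀ v τ, ∃ x : Vertex K μ n, x.v = v ∧ x.τ = τ ∧ IsJackAt α x (F (v, τ))) :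
    LinearIndependent K F := by
  classical
  rw [linearIndependent_iff']
  intro S g hg
  by_contra! hne
  obtain ⟨p, hp, hgp⟩ := hne
  obtain ⟨w, hw, hmax⟩ := exists_vecLT_maximal (S := (S.filter fun p => g p ≠ 0).image Prod.fst)
    ⟨p.1, Finset.mem_image_of_mem _ (Finset.mem_filter.2 ⟨hp, hgp⟩)⟩
  obtain ⟨⟨w', τ⟩, hq, rfl⟩ := Finset.mem_image.1 hw
  rw [Finset.mem_filter] at hq
  have h1 := congrArg (fun P => tabAct K μ (standardization w')⁻¹ (coeffEquiv K μ n P w') τ) hg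
  simp only [map_sum, map_smul, Finsupp.finsetSum_apply, Finsupp.smul_apply, map_zero,
    Finsupp.zero_apply] at h1
  rw [Finset.sum_eq_single (w', τ)] at h1
  · obtain ⟨x, hv, hτ, hx⟩ := hF w' τ
    have hc := hx.coeff_eq'
    rw [hv, hτ] at hc
    rw [hc, tabAct_apply_inv, Finsupp.single_eq_same, smul_eq_mul, mul_one] at h1
    exact hq.2 h1
  · rintro ⟨u, τ'⟩ hu hne
    by_cases hgu : g (u, τ') = 0
    · rw [hgu, zero_smul]
    obtain ⟨x, hv, hτ, hx⟩ := hF u τ'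
    by_cases huw : u = w'
    · have hc := hx.coeff_eq'
      subst huw
      rw [hv, hτ] at hc
      rw [hc, tabAct_apply_inv, Finsupp.single_eq_of_ne, smul_zero]
      rintro rfl
      exact hne rfl
    · have h0 : coeffEquiv K μ n (F (u, τ')) w' = 0 := by
        by_contra h0
        rcases hx.support hα h0 with h | h
        · exact huw (hv.symm.trans h.symm)
        · exact hmax u (Finset.mem_image_of_mem Prod.fst (Finset.mem_filter.2 ⟨hu, hgu⟩)) (hv ▸ h)
      rw [h0, map_zero, Finsupp.zero_apply, smul_zero]
  · exact fun h => absurd hq.1 h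

/-- `J_{v,τ}` and `x^{v,τ}` differ by lower terms, so well-founded induction on `◁` recovers each
`x^{v,τ}`. -/
theorem span_eq_top_of_isJackAt {α : K} (hα : Transcendental ℚ α)
    {F : (Fin (n + 1) → ℕ) × RST μ (n + 1) → M K μ n}
    (hF : ∀ v τ, ∃ x : Vertex K μ n, x.v = v ∧ x.τ = τ ∧ IsJackAt α x (F (v, τ))) :
    ⊤ ≤ Submodule.span K (Set.range F) := by
  have hmono : ∀ v τ, mono K v τ ∈ Submodule.span K (Set.range F) := by
    intro v
    induction v using VecLT.wellFounded.induction with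
    | _ v ih =>
    intro τ
    obtain ⟨x, rfl, rfl, hx⟩ := hF v τ
    have h1 := mem_of_mem_low (S := Submodule.span K (Set.range F)) (fun w τ hw => ih w hw τ)
      (hx.sub_mono_mem_low hα)
    have h2 : F (x.v, x.τ) ∈ Submodule.span K (Set.range F) := Submodule.subset_span ⟨_, rfl⟩
    have := Submodule.sub_mem _ h2 h1
    rwa [sub_sub_cancel] at this
  intro P _
  rw [eq_sum_xPow_tmul P]
  exact Submodule.sum_mem _ fun v _ => xPow_tmul_mem_of_mono_mem (hmono v) _

end Basis

end VectorJack

end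

theorem mainTheorem1 {K : Type*} [Field K] [CharZero K] (α : K) (hα : Transcendental ℚ α)
    (n : ℕ) (μ : YoungDiagram) (hμ : μ.cells.card = n + 1) :
    -- eigenfunctions, eigenvalues and leading monomials
    (∀ (x : VectorJack.Vertex K μ n) (P : VectorJack.Path α hμ (some x)),
      VectorJack.IsLeadingMonomial x.v x.τ (VectorJack.J P) ∧ VectorJack.J P ≠ 0 ∧
      ∀ i, VectorJack.xi μ α i (VectorJack.J P) = x.ζ i • VectorJack.J P) ∧
    -- the polynomial depends only on the end point
    (∀ (x : VectorJack.Vertex K μ n) (P Q : VectorJack.Path α hμ (some x)),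
      VectorJack.J P = VectorJack.J Q) ∧
    -- the resulting family, indexed by all pairs `(v, τ)`, is a basis of simultaneous eigenfunctions
    (∃ B : Module.Basis ((Fin (n + 1) → ℕ) × VectorJack.RST μ (n + 1)) K (VectorJack.M K μ n),
      (∀ v τ, ∃ (x : VectorJack.Vertex K μ n) (_ : VectorJack.Path α hμ (some x)),
        x.v = v ∧ x.τ = τ) ∧
      (∀ (x : VectorJack.Vertex K μ n) (P : VectorJack.Path α hμ (some x)),
        VectorJack.J P = B (x.v, x.τ)) ∧
      ∀ v τ i, ∃ c : K, VectorJack.xi μ α i (B (v, τ)) = c • B (v, τ)) ∧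
    -- paths leading to the extra vertex give zero
    (∀ P : VectorJack.Path α hμ none, VectorJack.J P = 0) := by
  have hJ : ∀ (x : VectorJack.Vertex K μ n) (P : VectorJack.Path α hμ (some x)),
      VectorJack.IsJackAt α x (VectorJack.J P) := fun x P => (VectorJack.isJackAt_J hα P).1 x rfl
  refine ⟨fun x P => ⟨(hJ x P).isLeadingMonomial hα, (hJ x P).ne_zero, (hJ x P).eigen⟩,
    fun x P Q => (hJ x P).unique hα (hJ x Q) rfl rfl, ?_,
    fun P => (VectorJack.isJackAt_J hα P).2 rfl⟩
  -- One path is chosen for each pair; by `IsJackAt.unique` the polynomial does not depend on the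
  -- choice.
  choose X Q hv hτ using VectorJack.reachable hα hμ
  let F : (Fin (n + 1) → ℕ) × VectorJack.RST μ (n + 1) → VectorJack.M K μ n :=
    fun p => VectorJack.J (Q p.1 p.2)
  have hF : ∀ v τ, ∃ x : VectorJack.Vertex K μ n, x.v = v ∧ x.τ = τ ∧
      VectorJack.IsJackAt α x (F (v, τ)) :=
    fun v τ => ⟨X v τ, hv v τ, hτ v τ, hJ _ _⟩
  refine ⟨Module.Basis.mk (VectorJack.linearIndependent_of_isJackAt (F := F) hα hF)
    (VectorJack.span_eq_top_of_isJackAt (F := F) hα hF), VectorJack.reachable hα hμ, fun x P => ?_,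
    fun v τ i => ⟨(X v τ).ζ i, ?_⟩⟩
  · rw [Module.Basis.mk_apply]
    exact (hJ x P).unique hα (hJ _ _) (hv _ _).symm (hτ _ _).symm
  · rw [Module.Basis.mk_apply]
    exact (hJ _ _).eigen i
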